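/- **Proposition 1 (Consistency).** Let $d\ge 2$ (in applications $d\in\{2,3\}$), and let $\mathcal T=\{\Omega_e\}$ be a finite face-to-face triangulation into $d$-simplices, with $\Omega=\overline{\bigcup_e\Omega_e}\subset\mathbb R^d$. Denote by $\Gamma_{e_i}$ the facets of $\Omega_e$, by $\mathbf n$ the outward unit normal to $\Omega_e$ on $\Gamma_{e_i}$, by $\mathcal F$ the set of all facets, by $\tilde\Gamma$ their union (the skeleton), and by $h_e$ the volume of $\Omega_e$ divided by the measure of $\partial\Omega_e$. Let $\partial\Omega=\Gamma_D\cup\Gamma_N$ with $\Gamma_D\cap\Gamma_N=\emptyset$ (measurable, up to null sets). For $k\ge1$ let $V^h$ (resp. $Q^h$) be the vector (resp. scalar) fields on $\Omega$ that are polynomials of degree at most $k$ (resp. $k-1$) on each element, $\hat V^h$ (resp. $\hat Q^h$) the vector (resp. scalar) fields on $\tilde\Gamma$ that are polynomials of degree at most $k$ on each facet, and $\hat V^h_0$ the set of $\hat{\mathbf v}^h\in\hat V^h$ that vanish on $\Gamma_D$. Let $\rho>0$, $\nu,C_{pen}\in\mathbb R$, and let $\nu_T,\mathbf f,\mathbf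 g,\mathbf h$ be given functions of time and position. Let $(\overline{\mathbf u},\overline p)$ satisfy the incompressible RANS equations for all times $t>0$: $$\partial_t\overline{\mathbf u}+\nabla\cdot(\overline{\mathbf u}\otimes\overline{\mathbf u})+\tfrac1\rho\nabla\overline p-\nabla\cdot\big(2(\nu+\nu_T)\nabla^S\overline{\mathbf u}\big)=\mathbf f,\qquad \nabla\cdot\overline{\mathbf u}=0\qquad\text{in the interior of }\Omega,$$ $$\overline{\mathbf u}=\mathbf g\ \text{ on }\Gamma_D,\qquad \big[-\tfrac1\rho\overline p\,\mathbf I+2(\nu+\nu_T)\nabla^S\overline{\mathbf u}\big]\cdot\mathbf n-\min(\overline{\mathbf u}\cdot\mathbf n,0)\,\overline{\mathbf u}+\mathbf h=\mathbf 0\ \text{ on }\Gamma_N,$$ the last equation holding almost everywhere on $\Gamma_N$. Suppose that they are sufficiently smooth: at each time $t>0$, $\overline{\mathbf u}$ is $C^2$ and $\overline p,\nu_T$ are $C^1$ in space up to the boundary of $\Omega$, and $\overline{\mathbf u}$ is differentiable in time with $\partial_t\overline{\mathbf u}$ continuous on $\Omega$. Then, at every time $t>0$, the following four equations of the semi-discrete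 HDG method hold with $\big(\overline{\mathbf u}^h,\hat{\overline{\mathbf u}}^h,\overline p^h,\hat{\overline p}^h\big)$ replaced by $\big(\overline{\mathbf u},\overline{\mathbf u}|_{\tilde\Gamma},\overline p,\overline p|_{\tilde\Gamma}\big)$, where $\lambda=1$ if $\overline{\mathbf u}^h\cdot\mathbf n<0$ and $\lambda=0$ otherwise. *Continuity equation*: for all $q^h\in Q^h$, $$\sum_e\int_{\Omega_e}\tfrac1\rho(\nabla\cdot\overline{\mathbf u}^h)\,q^h\,d\Omega=0.$$ *Continuity conservativity condition*: for all $\hat q^h\in\hat Q^h$, $$\sum_e\sum_i\int_{\Gamma_{e_i}}\tfrac1\rho\,\overline{\mathbf u}^h\cdot\mathbf n\,\hat q^h\,d\Gamma-\int_{\partial\Omega}\tfrac1\rho\,\hat{\overline{\mathbf u}}^h\cdot\mathbf n\,\hat q^h\,d\Gamma=0.$$ *Momentum equation*: for all $\mathbf v^h\in V^h$, $$\begin{aligned}&\int_\Omega\partial_t\overline{\mathbf u}^h\cdot\mathbf v^h\,d\Omega-\sum_e\int_{\Omega_e}(\overline{\mathbf u}^h\otimes\overline{\mathbf u}^h):\nabla\mathbf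 v^h\,d\Omega-\sum_e\int_{\Omega_e}\tfrac1\rho\overline p^h\mathbf I:\nabla\mathbf v^h\,d\Omega+\sum_e\int_{\Omega_e}2(\nu+\nu_T)\nabla^S\overline{\mathbf u}^h:\nabla^S\mathbf v^h\,d\Omega\\&+\sum_e\sum_i\int_{\Gamma_{e_i}}\Big[\overline{\mathbf u}^h\otimes\overline{\mathbf u}^h+(\hat{\overline{\mathbf u}}^h-\overline{\mathbf u}^h)\otimes\lambda\overline{\mathbf u}^h+\tfrac1\rho\hat{\overline p}^h\mathbf I-2(\nu+\nu_T)\nabla^S\overline{\mathbf u}^h-\tfrac{2C_{pen}}{h_e}(\nu+\nu_T)(\hat{\overline{\mathbf u}}^h-\overline{\mathbf u}^h)\otimes\mathbf n\Big]:(\mathbf v^h\otimes\mathbf n)\,d\Gamma\\&+\sum_e\sum_i\int_{\Gamma_{e_i}}2(\nu+\nu_T)\big[(\hat{\overline{\mathbf u}}^h-\overline{\mathbf u}^h)\otimes\mathbf n\big]:\nabla^S\mathbf v^h\,d\Gamma-\int_\Omega\mathbf f\cdot\mathbf v^h\,d\Omega=0.\end{aligned}$$ *Momentum conservativity condition*: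 for all $\hat{\mathbf v}^h\in\hat V_0^h$, $$\begin{aligned}-&\sum_e\sum_i\int_{\Gamma_{e_i}}\Big[\overline{\mathbf u}^h\otimes\overline{\mathbf u}^h+(\hat{\overline{\mathbf u}}^h-\overline{\mathbf u}^h)\otimes\lambda\overline{\mathbf u}^h+\tfrac1\rho\hat{\overline p}^h\mathbf I-2(\nu+\nu_T)\nabla^S\overline{\mathbf u}^h-\tfrac{2C_{pen}}{h_e}(\nu+\nu_T)(\hat{\overline{\mathbf u}}^h-\overline{\mathbf u}^h)\otimes\mathbf n\Big]:(\hat{\mathbf v}^h\otimes\mathbf n)\,d\Gamma\\&+\int_{\Gamma_N}(1-\lambda)(\hat{\overline{\mathbf u}}^h\cdot\mathbf n)(\hat{\overline{\mathbf u}}^h\cdot\hat{\mathbf v}^h)\,d\Gamma+\int_{\Gamma_N}\mathbf h\cdot\hat{\mathbf v}^h\,d\Gamma=0.\end{aligned}$$ -/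

import Mathlib

open MeasureTheory Set
open scoped RealInnerProductSpace Matrix

noncomputable section

namespace HDG

/-- Euclidean space `ℝ^d`. -/
abbrev E (d : ℕ) : Type := EuclideanSpace ℝ (Fin d)

/-! ### Tensor calculus -/

/-- The gradient `(∇ w)_{ij} = ∂_j w_i` of a vector field on a set `S` (up to the boundary of `S`). -/
def grad {d : ℕ} (S : Set (E d)) (w : E d → E d) (x : E d) : Matrix (Fin d) (Fin d) ℝ :=
  Matrix.of fun i j => fderivWithin ℝ w S x (EuclideanSpace.single j 1) i

/-- The symmetric gradient `∇^S w = (∇ w + (∇ w)ᵀ) / 2`. -/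
def symGrad {d : ℕ} (S : Set (E d)) (w : E d → E d) (x : E d) : Matrix (Fin d) (Fin d) ℝ :=
  (1 / 2 : ℝ) • (grad S w x + (grad S w x)ᵀ)

/-- The divergence of a vector field. -/
def divergence {d : ℕ} (S : Set (E d)) (w : E d → E d) (x : E d) : ℝ :=
  (grad S w x).trace

/-- The gradient of a scalar field, as a vector. -/
def scalarGrad {d : ℕ} (S : Set (E d)) (q : E d → ℝ) (x : E d) : E d :=
  WithLp.toLp 2 fun i => fderivWithin ℝ q S x (EuclideanSpace.single i 1)

/-- The (row-wise) divergence of a matrix field, `(∇ · A)_i = ∑_j ∂_j A_{ij}`. -/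
def tensorDiv {d : ℕ} (S : Set (E d)) (A : E d → Matrix (Fin d) (Fin d) ℝ) (x : E d) : E d :=
  WithLp.toLp 2 fun i =>
    ∑ j, fderivWithin ℝ (fun y => A y i j) S x (EuclideanSpace.single j 1)

/-- The tensor product `(a ⊗ b)_{ij} = a_i b_j`. -/
def outer {d : ℕ} (a b : E d) : Matrix (Fin d) (Fin d) ℝ :=
  Matrix.of fun i j => a i * b j

/-- The double contraction `A : B = ∑_{ij} A_{ij} B_{ij}`. -/
def ddot {d : ℕ} (A B : Matrix (Fin d) (Fin d) ℝ) : ℝ :=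
  ∑ i, ∑ j, A i j * B i j

/-- The product `A · v` of a matrix and a vector. -/
def matVec {d : ℕ} (A : Matrix (Fin d) (Fin d) ℝ) (v : E d) : E d :=
  WithLp.toLp 2 fun i => ∑ j, A i j * v j

/-! ### Meshes -/

/-- A triangulation: a finite face-to-face complex of simplices in `ℝ^d`, all of whose simplices
are faces of `d`-dimensional ones. Simplices are given by their vertex sets. -/
structure Mesh (d : ℕ) extends Geometry.SimplicialComplex ℝ (E d) where
  finite_faces : faces.Finite
  pure : ∀ s ∈ faces, ∃ T ∈ faces, s ⊆ T ∧ T.card = d + 1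

/-- The closed simplex with the given vertices. -/
abbrev hull {d : ℕ} (T : Finset (E d)) : Set (E d) := convexHull ℝ (T : Set (E d))

/-- The elements `Ω_e` of the mesh. -/
def Mesh.cells {d : ℕ} (M : Mesh d) : Finset (Finset (E d)) :=
  M.finite_faces.toFinset.filter fun T => T.card = d + 1

/-- The facets `F ∈ ℱ` of the mesh (edges if `d = 2`, faces if `d = 3`). -/
def Mesh.facets {d : ℕ} (M : Mesh d) : Finset (Finset (E d)) :=
  M.finite_faces.toFinset.filter fun F => F.card = d

/-- The closed meshed domain, that is the closure of the union of the elements. -/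
def Mesh.domain {d : ℕ} (M : Mesh d) : Set (E d) := M.toSimplicialComplex.space

open Classical in
/-- The facet of the element `T` opposite to its vertex `a`. -/
def opp {d : ℕ} (T : Finset (E d)) (a : E d) : Finset (E d) := T.erase a

/-- The unit normal to the facet of `T` opposite to the vertex `a`, pointing out of `T`: minus the
normalized altitude vector, which is the component of `a - b` orthogonal to the facet, where `b` is
any point of the facet. -/
def outwardNormal {d : ℕ} (T : Finset (E d)) (a : E d) : E d :=
  -NormedSpace.normalize
    ((vectorSpan ℝ (opp T a : Set (E d)))ᗮ.starProjection (a - (opp T a).centroid ℝ id))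

/-! ### Integrals over the mesh; `μHE[d - 1]` is the surface measure -/

/-- `∑_e ∫_{Ω_e} φ`. -/
def cellIntegral {d : ℕ} (M : Mesh d) (φ : Finset (E d) → E d → ℝ) : ℝ :=
  ∑ T ∈ M.cells, ∫ x in hull T, φ T x

/-- `∑_e ∑_i ∫_{Γ_{e_i}} φ`; the integrand may depend on the element, on the facet, on the outward
unit normal and on the point. -/
def facetIntegral {d : ℕ} (M : Mesh d)
    (φ : Finset (E d) → Finset (E d) → E d → E d → ℝ) : ℝ :=
  ∑ T ∈ M.cells, ∑ a ∈ T, ∫ x in hull (opp T a), φ T (opp T a) (outwardNormal T a) x ∂μHE[d - 1]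

open Classical in
/-- `∫_Γ φ` for a part `Γ` of the boundary of the domain, computed facet by facet. -/
def boundaryIntegral {d : ℕ} (M : Mesh d) (Γ : Set (E d))
    (φ : Finset (E d) → Finset (E d) → E d → E d → ℝ) : ℝ :=
  ∑ T ∈ M.cells, ∑ a ∈ T with hull (opp T a) ⊆ frontier M.domain,
    ∫ x in hull (opp T a) ∩ Γ, φ T (opp T a) (outwardNormal T a) x ∂μHE[d - 1]

/-- The mesh size `h_e`, the volume of an element divided by the measure of its boundary. -/
def meshSize {d : ℕ} (T : Finset (E d)) : ℝ :=
  (volume (hull T)).toReal / ∑ a ∈ T, (μHE[d - 1] (hull (opp T a))).toReal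

/-! ### Discrete fields and finite element spaces -/

/-- A field on the mesh cells, possibly discontinuous across facets: for each element, a function on
that closed element (its values elsewhere are irrelevant). -/
abbrev CellField (d : ℕ) (X : Type) : Type := Finset (E d) → E d → X

/-- A field on the mesh skeleton: for each facet, a function on that facet (its values elsewhere
are irrelevant). -/
abbrev TraceField (d : ℕ) (X : Type) : Type := Finset (E d) → E d → X

/-- `q ∈ P_k(S)`: on `S`, `q` is a polynomial of total degree at most `k`. -/
def IsPolyOn {d : ℕ} (k : ℕ) (S : Set (E d)) (q : E d → ℝ) : Prop :=
  ∃ P : MvPolynomial (Fin d) ℝ, P.totalDegree ≤ k ∧ ∀ x ∈ S, q x = MvPolynomial.eval (fun i => x i) P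

/-- The velocity space `V^h`. -/
def velocitySpace {d : ℕ} (M : Mesh d) (k : ℕ) : Set (CellField d (E d)) :=
  {v | ∀ T ∈ M.cells, ∀ i, IsPolyOn k (hull T) fun x => v T x i}

/-- The pressure space `Q^h`. -/
def pressureSpace {d : ℕ} (M : Mesh d) (k : ℕ) : Set (CellField d ℝ) :=
  {q | ∀ T ∈ M.cells, IsPolyOn (k - 1) (hull T) (q T)}

/-- The velocity trace space `V̂^h`. -/
def velocityTraceSpace {d : ℕ} (M : Mesh d) (k : ℕ) : Set (TraceField d (E d)) :=
  {v | ∀ F ∈ M.facets, ∀ i, IsPolyOn k (hull F) fun x => v F x i}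

/-- The pressure trace space `Q̂^h`. -/
def pressureTraceSpace {d : ℕ} (M : Mesh d) (k : ℕ) : Set (TraceField d ℝ) :=
  {q | ∀ F ∈ M.facets, IsPolyOn k (hull F) (q F)}

/-- The velocity trace test space `V̂^h_0`: traces that vanish on `Γ_D` (as `L²` functions, that is
almost everywhere for the surface measure). -/
def velocityTraceSpaceZero {d : ℕ} (M : Mesh d) (k : ℕ) (ΓD : Set (E d)) :
    Set (TraceField d (E d)) :=
  {v | v ∈ velocityTraceSpace M k ∧
    ∀ F ∈ M.facets, ∀ᵐ x ∂(μHE[d - 1].restrict (hull F ∩ ΓD)), v F x = 0}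

/-! ### The incompressible RANS problem -/

/-- The data of the incompressible RANS problem with a linear eddy viscosity model on the meshed
domain: density, molecular and eddy viscosity, body force, Dirichlet and Neumann data, and the
splitting of the boundary into a Dirichlet and a Neumann part. -/
structure RANSData {d : ℕ} (M : Mesh d) where
  ρ : ℝ
  ν : ℝ
  νT : ℝ → E d → ℝ
  f : ℝ → E d → E d
  g : ℝ → E d → E d
  h : ℝ → E d → E d
  ΓD : Set (E d)
  ΓN : Set (E d)
  ρ_pos : 0 < ρ
  measurableSet_ΓD : MeasurableSet ΓD
  measurableSet_ΓN : MeasurableSet ΓN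
  ΓD_subset : ΓD ⊆ frontier M.domain
  ΓN_subset : ΓN ⊆ frontier M.domain
  null_inter : μHE[d - 1] (ΓD ∩ ΓN) = 0
  null_compl : μHE[d - 1] (frontier M.domain \ (ΓD ∪ ΓN)) = 0

/-- The total viscosity `ν + ν_T`. -/
def RANSData.visc {d : ℕ} {M : Mesh d} (D : RANSData M) (t : ℝ) (x : E d) : ℝ := D.ν + D.νT t x

/-- `(u, p)` is an exact solution of the incompressible RANS equations that is smooth enough for the
equations to hold pointwise, all the terms being continuous up to the boundary. -/
structure IsSmoothSolution {d : ℕ} (M : Mesh d) (D : RANSData M)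
    (u : ℝ → E d → E d) (p : ℝ → E d → ℝ) : Prop where
  smooth_velocity : ∀ t > 0, ContDiffOn ℝ 2 (u t) M.domain
  smooth_pressure : ∀ t > 0, ContDiffOn ℝ 1 (p t) M.domain
  smooth_eddyViscosity : ∀ t > 0, ContDiffOn ℝ 1 (D.νT t) M.domain
  differentiable_time : ∀ t > 0, ∀ x ∈ M.domain, DifferentiableAt ℝ (fun s => u s x) t
  continuous_time : ∀ t > 0, ContinuousOn (fun x => deriv (fun s => u s x) t) M.domain
  momentum : ∀ t > 0, ∀ x ∈ interior M.domain,
    deriv (fun s => u s x) t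
      + tensorDiv M.domain (fun y => outer (u t y) (u t y)) x
      + (1 / D.ρ) • scalarGrad M.domain (p t) x
      - tensorDiv M.domain (fun y => (2 * D.visc t y) • symGrad M.domain (u t) y) x
      - D.f t x = 0
  continuity : ∀ t > 0, ∀ x ∈ interior M.domain, divergence M.domain (u t) x = 0
  dirichlet : ∀ t > 0, ∀ x ∈ D.ΓD, u t x = D.g t x
  /- The outward normal exists almost everywhere on the boundary, namely inside the facets. -/
  neumann : ∀ t > 0, ∀ T ∈ M.cells, ∀ a ∈ T, hull (opp T a) ⊆ frontier M.domain →
    ∀ᵐ x ∂(μHE[d - 1].restrict (hull (opp T a) ∩ D.ΓN)),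
      matVec (-(1 / D.ρ * p t x) • (1 : Matrix (Fin d) (Fin d) ℝ)
          + (2 * D.visc t x) • symGrad M.domain (u t) x) (outwardNormal T a)
        - min ⟪u t x, outwardNormal T a⟫ 0 • u t x
        + D.h t x = 0

/-! ### The semi-discrete HDG equations at time `t` -/

/-- The inflow indicator `λ`. -/
def inflow {d : ℕ} (w n : E d) : ℝ := open Classical in if ⟪w, n⟫ < 0 then 1 else 0

/-- Continuity equation. -/
def ContinuityEq {d : ℕ} (M : Mesh d) (D : RANSData M) (k : ℕ) (u : CellField d (E d)) : Prop :=
  ∀ q ∈ pressureSpace M k,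
    cellIntegral M (fun T x => 1 / D.ρ * divergence (hull T) (u T) x * q T x) = 0

/-- Continuity conservativity condition. -/
def ContinuityConservativity {d : ℕ} (M : Mesh d) (D : RANSData M) (k : ℕ)
    (u : CellField d (E d)) (uhat : TraceField d (E d)) : Prop :=
  ∀ q ∈ pressureTraceSpace M k,
    facetIntegral M (fun T F n x => 1 / D.ρ * ⟪u T x, n⟫ * q F x)
      - boundaryIntegral M (frontier M.domain)
          (fun _ F n x => 1 / D.ρ * ⟪uhat F x, n⟫ * q F x) = 0

/-- Momentum equation; here the cell velocity `u` depends on time. -/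
def MomentumEq {d : ℕ} (M : Mesh d) (D : RANSData M) (k : ℕ) (Cpen t : ℝ)
    (u : ℝ → CellField d (E d)) (uhat : TraceField d (E d))
    (p : CellField d ℝ) (phat : TraceField d ℝ) : Prop :=
  ∀ v ∈ velocitySpace M k,
    cellIntegral M (fun T x => ⟪deriv (fun s => u s T x) t, v T x⟫)
      - cellIntegral M (fun T x => ddot (outer (u t T x) (u t T x)) (grad (hull T) (v T) x))
      - cellIntegral M (fun T x =>
          ddot ((1 / D.ρ * p T x) • (1 : Matrix (Fin d) (Fin d) ℝ)) (grad (hull T) (v T) x))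
      + cellIntegral M (fun T x =>
          ddot ((2 * D.visc t x) • symGrad (hull T) (u t T) x) (symGrad (hull T) (v T) x))
      + facetIntegral M (fun T _ n x => ddot (outer (u t T x) (u t T x)) (outer (v T x) n))
      + facetIntegral M (fun T F n x =>
          ddot (outer (uhat F x - u t T x) (inflow (u t T x) n • u t T x)) (outer (v T x) n))
      + facetIntegral M (fun T F n x =>
          ddot ((1 / D.ρ * phat F x) • (1 : Matrix (Fin d) (Fin d) ℝ)) (outer (v T x) n))
      - facetIntegral M (fun T _ n x =>
          ddot ((2 * D.visc t x) • symGrad (hull T) (u t T) x) (outer (v T x) n))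
      - facetIntegral M (fun T F n x =>
          ddot ((2 * Cpen / meshSize T * D.visc t x) • outer (uhat F x - u t T x) n)
            (outer (v T x) n))
      + facetIntegral M (fun T F n x =>
          ddot ((2 * D.visc t x) • outer (uhat F x - u t T x) n) (symGrad (hull T) (v T) x))
      - cellIntegral M (fun T x => ⟪D.f t x, v T x⟫) = 0

/-- Momentum conservativity condition. -/
def MomentumConservativity {d : ℕ} (M : Mesh d) (D : RANSData M) (k : ℕ) (Cpen t : ℝ)
    (u : CellField d (E d)) (uhat : TraceField d (E d)) (phat : TraceField d ℝ) : Prop :=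
  ∀ vhat ∈ velocityTraceSpaceZero M k D.ΓD,
    - facetIntegral M (fun T F n x => ddot (outer (u T x) (u T x)) (outer (vhat F x) n))
      - facetIntegral M (fun T F n x =>
          ddot (outer (uhat F x - u T x) (inflow (u T x) n • u T x)) (outer (vhat F x) n))
      - facetIntegral M (fun _ F n x =>
          ddot ((1 / D.ρ * phat F x) • (1 : Matrix (Fin d) (Fin d) ℝ)) (outer (vhat F x) n))
      + facetIntegral M (fun T F n x =>
          ddot ((2 * D.visc t x) • symGrad (hull T) (u T) x) (outer (vhat F x) n))
      + facetIntegral M (fun T F n x =>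
          ddot ((2 * Cpen / meshSize T * D.visc t x) • outer (uhat F x - u T x) n)
            (outer (vhat F x) n))
      + boundaryIntegral M D.ΓN (fun T F n x =>
          (1 - inflow (u T x) n) * ⟪uhat F x, n⟫ * ⟪uhat F x, vhat F x⟫)
      + boundaryIntegral M D.ΓN (fun _ F _ x => ⟪D.h t x, vhat F x⟫) = 0

end HDG

end

/-!
A smooth solution is single-valued on the facets, so every term of the method containing the jump
`û - u` vanishes. What remains of the continuity equation holds pointwise inside the cells. What
remains of the momentum equation is, cell by cell, the RANS momentum equation tested with `v` and
integrated by parts (`IsSmoothSolution.momentum_cell`). In the two conservativity conditions the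
integrand is the normal component of a field that depends on the facet but not on the cell; its
contributions cancel on the interior facets (`Mesh.facetIntegral_eq_boundary`). On the boundary
nothing else is left in the continuity condition, and in the momentum condition the rest is
compensated by the Neumann data, because the test traces vanish on the Dirichlet part and
`λ (u · n) = min (u · n) 0` (`IsSmoothSolution.momentum_boundary_facet`).

Two ingredients have to be built.

* The divergence theorem on a simplex (`IsSimplex.integral_fderivWithin`). By linearity in the
  direction it suffices to differentiate along an edge `b - a`. Lines parallel to this edge enter
  the simplex through the facet opposite to `b`, leave it through the facet opposite to `a`, and
  stay parallel to all other facets, so the claim is the fundamental theorem of calculus on each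
  chord together with Fubini. Lebesgue measure splits as `|⟪c, n⟫|` times surface measure on a
  hyperplane with unit normal `n` times length along `c` (`map_add_smul_surfaceMeasure`). Computing
  the volume of one prism from two hyperplanes shows that the projection along `c` between
  them preserves `|⟪c, n⟫|` times surface measure (`map_projection_surfaceMeasure`); this moves the
  exit points to their own facet.
* The combinatorics of facets. Two different cells with a common facet lie on different sides of it
  (`Mesh.coord_neg_of_opp_eq`), otherwise they would overlap outside of their common face. Hence
  their normals are opposite, and there are at most two of them. If the facet meets the interior of
  the domain, then there are two: points just beyond it lie in some cell, which has to contain the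
  facet (`Mesh.exists_opp_eq_of_not_subset_frontier`).
-/

noncomputable section

namespace HDG

open Filter Topology

variable {d : ℕ}

/-! ### Surface measure on hyperplanes and integration along lines -/

/-- The hyperplane through `p` with normal vector `n`. -/
def hyperplane (p n : E d) : Set (E d) := {x | ⟪x - p, n⟫ = 0}

lemma range_add_orthogonal (p n : E d) :
    range (fun w : (ℝ ∙ n)ᗮ => p + (w : E d)) = hyperplane p n := by
  ext x
  simp only [mem_range, Subtype.exists, hyperplane, mem_ofPred_eq]
  constructor
  · rintro ⟨w, hw, rfl⟩
    rw [Submodule.mem_orthogonal_singleton_iff_inner_left] at hw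
    simpa using hw
  · intro hx
    exact ⟨x - p, by rwa [Submodule.mem_orthogonal_singleton_iff_inner_left], by simp⟩

lemma isometry_add_orthogonal (p n : E d) :
    Isometry (fun w : (ℝ ∙ n)ᗮ => p + (w : E d)) :=
  (IsometryEquiv.addLeft p).isometry.comp isometry_subtype_coe

lemma finrank_orthogonal_span_unit {n : E d} (hn : ‖n‖ = 1) :
    Module.finrank ℝ (ℝ ∙ n)ᗮ = d - 1 := by
  have h := (ℝ ∙ n).finrank_add_finrank_orthogonal
  rw [finrank_span_singleton (norm_ne_zero_iff.1 (by rw [hn]; exact one_ne_zero)),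
    finrank_euclideanSpace_fin] at h
  omega

/-- The surface measure on a hyperplane is the Lebesgue measure of its direction space. -/
lemma surfaceMeasure_restrict_hyperplane (p : E d) {n : E d} (hn : ‖n‖ = 1) :
    (μHE[d - 1] : Measure (E d)).restrict (hyperplane p n) =
      (volume : Measure (ℝ ∙ n)ᗮ).map fun w : (ℝ ∙ n)ᗮ => p + (w : E d) := by
  rw [← range_add_orthogonal, ← (isometry_add_orthogonal p n).map_euclideanHausdorffMeasure,
    ← finrank_orthogonal_span_unit hn, InnerProductSpace.euclideanHausdorffMeasure_eq_volume]

lemma sFinite_restrict_hyperplane (p : E d) {n : E d} (hn : ‖n‖ = 1) :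
    SFinite ((μHE[d - 1] : Measure (E d)).restrict (hyperplane p n)) := by
  rw [surfaceMeasure_restrict_hyperplane p hn]
  infer_instance

lemma isClosed_hyperplane (p n : E d) : IsClosed (hyperplane p n) :=
  isClosed_eq (by fun_prop) continuous_const

lemma surfaceMeasure_lt_top_of_isCompact {p n : E d} (hn : ‖n‖ = 1) {K : Set (E d)}
    (hK : IsCompact K) (hKH : K ⊆ hyperplane p n) : (μHE[d - 1] : Measure (E d)) K < ⊤ := by
  have hiso := isometry_add_orthogonal p n
  rw [← inter_eq_left.2 hKH, ← Measure.restrict_apply hK.measurableSet,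
    surfaceMeasure_restrict_hyperplane p hn,
    Measure.map_apply hiso.continuous.measurable hK.measurableSet]
  exact (hiso.isClosedEmbedding.isCompact_preimage hK).measure_lt_top

/-- Lebesgue measure is the product of the measure of a hyperplane and length along its normal. -/
lemma map_add_smul_normal (p : E d) {n : E d} (hn : ‖n‖ = 1) :
    (((volume : Measure (ℝ ∙ n)ᗮ).prod (volume : Measure ℝ)).map
      fun z => p + ((z.1 : E d) + z.2 • n)) = volume := by
  have h1 := ((ℝ ∙ n).measurePreserving_measurableEquivProd p).symm.map_eq
  have h2 := (LinearIsometryEquiv.toSpanUnitSingleton (𝕜 := ℝ) n hn).measurePreserving.map_eq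
  rw [finrank_euclideanSpace_fin, EuclideanSpace.euclideanHausdorffMeasure_eq_volume] at h1
  rw [← h1, Measure.volume_eq_prod, ← h2]
  conv_rhs => rw [← Measure.prod_swap]
  conv_rhs =>
    enter [2, 2]
    rw [← Measure.map_id (μ := (volume : Measure (ℝ ∙ n)ᗮ))]
  rw [Measure.map_prod_map _ _ measurable_id (by fun_prop),
    Measure.map_map (by fun_prop) (by fun_prop), Measure.map_map (by fun_prop) (by fun_prop)]
  congr 1
  ext z : 1
  simp [add_comm]

/-- Cavalieri's principle for slices parallel to a hyperplane with unit normal `n`, in an oblique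
direction `c`: Lebesgue measure is surface measure times `|⟪c, n⟫| ds`. -/
lemma map_add_smul_surfaceMeasure (p : E d) {n c : E d} (hn : ‖n‖ = 1) (hc : ⟪c, n⟫ ≠ 0) :
    ((((μHE[d - 1] : Measure (E d)).restrict (hyperplane p n)).prod (volume : Measure ℝ)).map
      fun z => z.1 + z.2 • c) = ENNReal.ofReal |⟪c, n⟫|⁻¹ • volume := by
  -- The linear map fixing `nᗮ` and sending `n` to `c`, a rank one perturbation of the identity.
  let L : E d →ₗ[ℝ] E d := LinearMap.transvection (innerₛₗ ℝ n) (c - n)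
  have hdet : LinearMap.det L = ⟪c, n⟫ := by
    simp only [L, LinearMap.transvection.det]
    simp [inner_sub_right, hn, real_inner_comm]
  have hL := Measure.map_linearMap_addHaar_eq_smul_addHaar (volume : Measure (E d))
    (f := L) (by rwa [hdet])
  have hLm : Measurable L := L.continuous_of_finiteDimensional.measurable
  rw [hdet, abs_inv] at hL
  rw [surfaceMeasure_restrict_hyperplane p hn, ← hL]
  have h0 := map_add_smul_normal 0 hn
  conv_rhs => rw [← h0]
  -- Lebesgue measure is translation invariant, which reduces the claim to `p = 0`.
  have := congrArg (Measure.map (fun x => p + x))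
    (Measure.map_map hLm (f := fun z : (ℝ ∙ n)ᗮ × ℝ => 0 + ((z.1 : E d) + z.2 • n))
    (μ := (volume : Measure (ℝ ∙ n)ᗮ).prod (volume : Measure ℝ)) (by fun_prop))
  rw [h0, hL, Measure.map_smul, map_add_left_eq_self, ← hL, Measure.map_map (by fun_prop)
    (hLm.comp (by fun_prop))] at this
  rw [h0, this]
  conv_lhs =>
    enter [2, 2]
    rw [← Measure.map_id (μ := (volume : Measure ℝ))]
  rw [Measure.map_prod_map _ _ (by fun_prop) measurable_id,
    Measure.map_map (by fun_prop) (by fun_prop)]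
  congr 1
  ext z : 1
  have hz : ⟪n, (z.1 : E d)⟫ = 0 := Submodule.mem_orthogonal_singleton_iff_inner_right.1 z.1.2
  simp only [Function.comp_apply, Prod.map_fst, Prod.map_snd, id_eq, zero_add, L,
    LinearMap.transvection.apply, innerₛₗ_apply_apply, inner_add_right, inner_smul_right, hz,
    real_inner_self_eq_norm_sq, hn, one_pow, mul_one]
  module

/-- The surface measure of the part of a transversal hyperplane that projects along `c` into `A`,
expressed by the volume of a prism which does not depend on the hyperplane. -/
lemma surfaceMeasure_projection_preimage (p : E d) {n c : E d} (hn : ‖n‖ = 1) (hc : ⟪c, n⟫ ≠ 0)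
    (α : E d →ᵃ[ℝ] ℝ) (hα : α.linear c = -1) {A : Set (E d)} (hA : MeasurableSet A) :
    (μHE[d - 1] : Measure (E d)).restrict (hyperplane p n) {y | y + α y • c ∈ A} =
      ENNReal.ofReal |⟪c, n⟫|⁻¹ * volume {x | x + α x • c ∈ A ∧ -α x ∈ Icc (0 : ℝ) 1} := by
  have hαm : Measurable α := α.continuous_of_finiteDimensional.measurable
  have hB : MeasurableSet {y | y + α y • c ∈ A} :=
    (measurable_id.add (hαm.smul_const c)) hA
  have hS : MeasurableSet {x | x + α x • c ∈ A ∧ -α x ∈ Icc (0 : ℝ) 1} :=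
    hB.inter (hαm.neg measurableSet_Icc)
  have := sFinite_restrict_hyperplane p hn
  rw [← smul_eq_mul, ← Measure.smul_apply, ← map_add_smul_surfaceMeasure p hn hc,
    Measure.map_apply (by fun_prop) hS, Measure.prod_apply ((by fun_prop :
      Measurable fun z : E d × ℝ => z.1 + z.2 • c) hS), ← lintegral_indicator_one hB]
  refine lintegral_congr fun y => ?_
  have hline (s : ℝ) : α (y + s • c) = α y - s := by
    rw [add_comm, ← vadd_eq_add, α.map_vadd, map_smul, hα]
    simp [sub_eq_neg_add]
  by_cases hy : y + α y • c ∈ A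
  · have : Prod.mk y ⁻¹' ((fun z : E d × ℝ => z.1 + z.2 • c) ⁻¹'
        {x | x + α x • c ∈ A ∧ -α x ∈ Icc (0 : ℝ) 1}) = Icc (α y) (α y + 1) := by
      ext s
      have : y + s • c + (α y - s) • c = y + α y • c := by module
      simp only [mem_preimage, mem_ofPred_eq, hline, this, hy, true_and, mem_Icc]
      constructor <;> rintro ⟨h1, h2⟩ <;> constructor <;> linarith
    rw [this, indicator_of_mem (by exact hy)]
    simp
  · have : Prod.mk y ⁻¹' ((fun z : E d × ℝ => z.1 + z.2 • c) ⁻¹'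
        {x | x + α x • c ∈ A ∧ -α x ∈ Icc (0 : ℝ) 1}) = ∅ := by
      ext s
      have : y + s • c + (α y - s) • c = y + α y • c := by module
      simp [hline, this, hy]
    rw [this, indicator_of_notMem (by exact hy)]
    simp

/-- The projection along `c` of a hyperplane onto the transversal hyperplane `α = 0` multiplies the
surface measure by the ratio of the cosines between `c` and the two normals. -/
lemma map_projection_surfaceMeasure (p₁ p₂ : E d) {n₁ n₂ c : E d} (hn₁ : ‖n₁‖ = 1) (hn₂ : ‖n₂‖ = 1)
    (hc₁ : ⟪c, n₁⟫ ≠ 0) (hc₂ : ⟪c, n₂⟫ ≠ 0) (α : E d →ᵃ[ℝ] ℝ) (hα : α.linear c = -1)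
    (h₂ : ∀ x ∈ hyperplane p₂ n₂, α x = 0) :
    ENNReal.ofReal |⟪c, n₁⟫| •
        ((μHE[d - 1] : Measure (E d)).restrict (hyperplane p₁ n₁)).map (fun y => y + α y • c) =
      ENNReal.ofReal |⟪c, n₂⟫| • (μHE[d - 1] : Measure (E d)).restrict (hyperplane p₂ n₂) := by
  have hαm : Measurable α := α.continuous_of_finiteDimensional.measurable
  have hm : Measurable fun y => y + α y • c := measurable_id.add (hαm.smul_const c)
  ext A hA
  have hA₂ : (μHE[d - 1] : Measure (E d)).restrict (hyperplane p₂ n₂) A =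
      (μHE[d - 1] : Measure (E d)).restrict (hyperplane p₂ n₂) {y | y + α y • c ∈ A} := by
    refine measure_congr ?_
    filter_upwards [ae_restrict_mem (isClosed_hyperplane p₂ n₂).measurableSet] with y hy
    have : (y ∈ A) = (y + α y • c ∈ A) := by simp [h₂ y hy]
    exact this
  have hinv {r : ℝ} (hr : r ≠ 0) (v : ENNReal) :
      ENNReal.ofReal |r| * (ENNReal.ofReal |r|⁻¹ * v) = v := by
    rw [← mul_assoc, ← ENNReal.ofReal_mul (abs_nonneg r), mul_inv_cancel₀ (abs_ne_zero.2 hr)]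
    simp
  rw [Measure.smul_apply, Measure.smul_apply, Measure.map_apply hm hA, hA₂, smul_eq_mul,
    smul_eq_mul, surfaceMeasure_projection_preimage p₂ hn₂ hc₂ α hα hA, hinv hc₂]
  exact (congrArg _ (surfaceMeasure_projection_preimage p₁ hn₁ hc₁ α hα hA)).trans (hinv hc₁ _)

/-- Integration along lines parallel to `c`, over a hyperplane with unit normal `n`. -/
lemma integral_eq_integral_lines (p : E d) {n c : E d} (hn : ‖n‖ = 1) (hc : ⟪c, n⟫ ≠ 0)
    {f : E d → ℝ} (hf : Integrable f) :
    ∫ x, f x = |⟪c, n⟫| * ∫ y in hyperplane p n, (∫ s : ℝ, f (y + s • c)) ∂μHE[d - 1] := by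
  have := sFinite_restrict_hyperplane p hn
  have hmap := map_add_smul_surfaceMeasure p hn hc
  have hf' : Integrable f (((((μHE[d - 1] : Measure (E d)).restrict (hyperplane p n)).prod
      (volume : Measure ℝ)).map fun z => z.1 + z.2 • c)) := by
    rw [hmap]
    exact hf.smul_measure ENNReal.ofReal_ne_top
  have hm : Measurable fun z : E d × ℝ => z.1 + z.2 • c := by fun_prop
  have h1 := integral_map hm.aemeasurable hf'.aestronglyMeasurable
  rw [integral_prod (fun z : E d × ℝ => f (z.1 + z.2 • c)) (hf'.comp_measurable hm), hmap,
    integral_smul_measure,     ENNReal.toReal_ofReal (by positivity), smul_eq_mul] at h1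
  rw [← h1, mul_inv_cancel_left₀ (abs_ne_zero.2 hc)]

/-- Change of variables under the projection along `c` between two hyperplanes. -/
lemma integral_comp_projection (p₁ p₂ : E d) {n₁ n₂ c : E d} (hn₁ : ‖n₁‖ = 1) (hn₂ : ‖n₂‖ = 1)
    (hc₁ : ⟪c, n₁⟫ ≠ 0) (hc₂ : ⟪c, n₂⟫ ≠ 0) (α : E d →ᵃ[ℝ] ℝ) (hα : α.linear c = -1)
    (h₂ : ∀ x ∈ hyperplane p₂ n₂, α x = 0) {f : E d → ℝ}
    (hf : AEStronglyMeasurable f ((μHE[d - 1] : Measure (E d)).restrict (hyperplane p₂ n₂))) :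
    |⟪c, n₁⟫| * ∫ y in hyperplane p₁ n₁, f (y + α y • c) ∂μHE[d - 1] =
      |⟪c, n₂⟫| * ∫ y in hyperplane p₂ n₂, f y ∂μHE[d - 1] := by
  have hαm : Measurable α := α.continuous_of_finiteDimensional.measurable
  have hm : Measurable fun y => y + α y • c := measurable_id.add (hαm.smul_const c)
  have h := map_projection_surfaceMeasure p₁ p₂ hn₁ hn₂ hc₁ hc₂ α hα h₂
  have hpos : ENNReal.ofReal |⟪c, n₁⟫| ≠ 0 := by simpa using hc₁
  have hf₁ : AEStronglyMeasurable f
      (((μHE[d - 1] : Measure (E d)).restrict (hyperplane p₁ n₁)).map (fun y => y + α y • c)) := by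
    refine AEStronglyMeasurable.mono_ac ?_ hf
    refine (Measure.absolutelyContinuous_smul hpos).trans ?_
    rw [h]
    exact Measure.smul_absolutelyContinuous
  rw [← integral_map hm.aemeasurable hf₁]
  have := congrArg (fun μ : Measure (E d) => ∫ x, f x ∂μ) h
  simpa only [integral_smul_measure, ENNReal.toReal_ofReal (abs_nonneg _), smul_eq_mul] using this

/-! ### Barycentric coordinates and outward normals -/

/-- `T` is the vertex set of a nondegenerate `d`-dimensional simplex. -/
structure IsSimplex (T : Finset (E d)) : Prop where
  indep : AffineIndependent ℝ ((↑) : T → E d)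
  card : T.card = d + 1

lemma hull_opp_subset (T : Finset (E d)) (a : E d) : hull (opp T a) ⊆ hull T :=
  convexHull_mono (by simp [opp])

namespace IsSimplex

variable {T : Finset (E d)}

/-- The vertices of a `d`-simplex as an affine basis of `ℝ^d`. -/
def basis (hT : IsSimplex T) : AffineBasis T ℝ (E d) where
  toFun := (↑)
  ind' := hT.indep
  tot' := by
    rw [hT.indep.affineSpan_eq_top_iff_card_eq_finrank_add_one]
    simp [hT.card]

open Classical in
/-- The barycentric coordinate of the vertex `a`, with the value `0` if `a` is not a vertex. -/
def coord (hT : IsSimplex T) (a : E d) : E d →ᵃ[ℝ] ℝ :=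
  if ha : a ∈ T then hT.basis.coord ⟨a, ha⟩ else 0

lemma coord_of_mem (hT : IsSimplex T) {a : E d} (ha : a ∈ T) :
    hT.coord a = hT.basis.coord ⟨a, ha⟩ :=
  dif_pos ha

lemma coord_self (hT : IsSimplex T) {a : E d} (ha : a ∈ T) : hT.coord a a = 1 := by
  rw [hT.coord_of_mem ha]
  exact hT.basis.coord_apply_eq ⟨a, ha⟩

lemma coord_of_ne (hT : IsSimplex T) {a b : E d} (hb : b ∈ T) (hab : a ≠ b) : hT.coord a b = 0 := by
  by_cases ha : a ∈ T
  · rw [hT.coord_of_mem ha]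
    exact hT.basis.coord_apply_ne (i := ⟨a, ha⟩) (j := ⟨b, hb⟩) (by simpa using hab)
  · simp [coord, ha]

lemma continuous_coord (hT : IsSimplex T) (a : E d) : Continuous (hT.coord a) :=
  (hT.coord a).continuous_of_finiteDimensional

lemma sum_coord (hT : IsSimplex T) (x : E d) : ∑ a ∈ T, hT.coord a x = 1 := by
  rw [← hT.basis.sum_coord_apply_eq_one x, ← Finset.sum_coe_sort]
  exact Finset.sum_congr rfl fun a _ => by rw [hT.coord_of_mem a.2]

lemma sum_coord_smul (hT : IsSimplex T) (x : E d) : ∑ a ∈ T, hT.coord a x • a = x := by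
  conv_rhs => rw [← hT.basis.linear_combination_coord_eq_self x]
  rw [← Finset.sum_coe_sort]
  exact Finset.sum_congr rfl fun a _ => by rw [hT.coord_of_mem a.2]; rfl

lemma mem_hull_iff (hT : IsSimplex T) {x : E d} : x ∈ hull T ↔ ∀ a ∈ T, 0 ≤ hT.coord a x := by
  have h := hT.basis.convexHull_eq_nonneg_coord
  have hr : range hT.basis = (T : Set (E d)) := Subtype.range_coe
  rw [hr] at h
  rw [hull, h]
  simp only [mem_ofPred_eq, Subtype.forall]
  exact forall₂_congr fun a ha => by rw [hT.coord_of_mem ha]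

lemma nonempty_interior_hull (hT : IsSimplex T) : (interior (hull T)).Nonempty := by
  have hr : range hT.basis = (T : Set (E d)) := Subtype.range_coe
  rw [hull, ← hr]
  exact ⟨_, hT.basis.centroid_mem_interior_convexHull⟩

lemma coord_eq_zero_of_mem_opp (hT : IsSimplex T) {a b : E d} (hb : b ∈ opp T a) :
    hT.coord a b = 0 := by
  classical
  rw [opp, Finset.mem_erase] at hb
  exact hT.coord_of_ne hb.2 hb.1.symm

/-- A facet is cut out of the simplex by the vanishing of the opposite barycentric coordinate. -/
lemma mem_hull_opp_iff (hT : IsSimplex T) {a x : E d} (ha : a ∈ T) :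
    x ∈ hull (opp T a) ↔ hT.coord a x = 0 ∧ ∀ b ∈ T, 0 ≤ hT.coord b x := by
  classical
  constructor
  · intro hx
    refine ⟨?_, hT.mem_hull_iff.1 (convexHull_mono (by simp [opp]) hx)⟩
    have hsub : hull (opp T a) ⊆ {x | hT.coord a x = 0} := by
      refine convexHull_min (fun b hb => hT.coord_eq_zero_of_mem_opp hb) ?_
      exact (convex_singleton (0 : ℝ)).affine_preimage (hT.coord a)
    exact hsub hx
  · rintro ⟨h0, h⟩
    rw [hull, Finset.mem_convexHull']
    have hs := hT.sum_coord x
    have hx := hT.sum_coord_smul x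
    rw [← Finset.add_sum_erase _ _ ha, h0] at hs hx
    exact ⟨fun b => hT.coord b x, fun b hb => h b (Finset.mem_of_mem_erase hb),
      by simpa [opp] using hs, by simpa [opp] using hx⟩

lemma mem_hull_opp_iff' (hT : IsSimplex T) {a x : E d} (ha : a ∈ T) :
    x ∈ hull (opp T a) ↔ x ∈ hull T ∧ hT.coord a x = 0 := by
  rw [hT.mem_hull_opp_iff ha, hT.mem_hull_iff, and_comm]

lemma card_opp (hT : IsSimplex T) {a : E d} (ha : a ∈ T) : (opp T a).card = d := by
  classical
  rw [opp, Finset.card_erase_of_mem ha, hT.card, Nat.add_sub_cancel]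

lemma coord_add (hT : IsSimplex T) (a x v : E d) :
    hT.coord a (x + v) = hT.coord a x + (hT.coord a).linear v := by
  rw [add_comm, ← vadd_eq_add, (hT.coord a).map_vadd, vadd_eq_add, add_comm]

lemma coord_linear_sub (hT : IsSimplex T) (a x y : E d) :
    (hT.coord a).linear (x - y) = hT.coord a x - hT.coord a y := by
  rw [← vsub_eq_sub, (hT.coord a).linearMap_vsub, vsub_eq_sub]

/-- The gradient of the barycentric coordinate of `a`. -/
def coordGrad (hT : IsSimplex T) (a : E d) : E d :=
  (InnerProductSpace.toDual ℝ (E d)).symm (LinearMap.toContinuousLinearMap (hT.coord a).linear)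

lemma inner_coordGrad (hT : IsSimplex T) (a v : E d) :
    ⟪hT.coordGrad a, v⟫ = (hT.coord a).linear v := by
  simp [coordGrad]

lemma coordGrad_ne_zero (hT : IsSimplex T) (hd : 1 ≤ d) {a : E d} (ha : a ∈ T) :
    hT.coordGrad a ≠ 0 := by
  obtain ⟨b, hb⟩ := Finset.card_pos.1 (by rw [hT.card_opp ha]; omega : 0 < (opp T a).card)
  intro h
  have := hT.inner_coordGrad a (a - b)
  rw [h, inner_zero_left, hT.coord_linear_sub, hT.coord_self ha,
    hT.coord_eq_zero_of_mem_opp hb] at this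
  norm_num at this

/-- The direction of a facet is the orthogonal complement of the gradient of the opposite
barycentric coordinate. -/
lemma vectorSpan_opp (hT : IsSimplex T) (hd : 1 ≤ d) {a : E d} (ha : a ∈ T) :
    vectorSpan ℝ (opp T a : Set (E d)) = (ℝ ∙ hT.coordGrad a)ᗮ := by
  classical
  apply le_antisymm
  · rw [vectorSpan_def, Submodule.span_le]
    rintro _ ⟨x, hx, y, hy, rfl⟩
    rw [SetLike.mem_coe, Submodule.mem_orthogonal_singleton_iff_inner_right, hT.inner_coordGrad]
    simp only [vsub_eq_sub]
    rw [hT.coord_linear_sub, hT.coord_eq_zero_of_mem_opp hx, hT.coord_eq_zero_of_mem_opp hy,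
      sub_zero]
  · obtain ⟨b₀, hb₀⟩ := Finset.card_pos.1 (by rw [hT.card_opp ha]; omega : 0 < (opp T a).card)
    intro v hv
    rw [Submodule.mem_orthogonal_singleton_iff_inner_right, hT.inner_coordGrad] at hv
    have h1 : hT.coord a (b₀ + v) = 0 := by
      rw [hT.coord_add, hv, hT.coord_eq_zero_of_mem_opp hb₀, add_zero]
    have hs := hT.sum_coord (b₀ + v)
    have hx := hT.sum_coord_smul (b₀ + v)
    rw [← Finset.add_sum_erase _ _ ha, h1, zero_add] at hs
    rw [← Finset.add_sum_erase _ _ ha, h1, zero_smul, zero_add] at hx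
    have hv' : v = ∑ b ∈ T.erase a, hT.coord b (b₀ + v) • (b - b₀) := by
      simp only [smul_sub, Finset.sum_sub_distrib, hx, ← Finset.sum_smul, hs, one_smul,
        add_sub_cancel_left]
    rw [hv']
    refine Submodule.sum_mem _ fun b hb => Submodule.smul_mem _ _ ?_
    exact vsub_mem_vectorSpan ℝ (by exact hb) (by exact hb₀)

/-- The outward normal is the normalized opposite of the gradient of the opposite barycentric
coordinate. -/
lemma outwardNormal_eq (hT : IsSimplex T) (hd : 1 ≤ d) {a : E d} (ha : a ∈ T) :
    outwardNormal T a = -(‖hT.coordGrad a‖⁻¹ • hT.coordGrad a) := by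
  have hne : (opp T a).Nonempty := Finset.card_pos.1 (by rw [hT.card_opp ha]; omega)
  have hg := hT.coordGrad_ne_zero hd ha
  have hc : hT.coord a ((opp T a).centroid ℝ id) = 0 :=
    ((hT.mem_hull_opp_iff ha).1 ((opp T a).centroid_mem_convexHull hne)).1
  have hproj : (vectorSpan ℝ (opp T a : Set (E d)))ᗮ.starProjection
      (a - (opp T a).centroid ℝ id) = (‖hT.coordGrad a‖ ^ 2)⁻¹ • hT.coordGrad a := by
    have hW := hT.vectorSpan_opp hd ha
    refine Submodule.eq_starProjection_of_mem_of_inner_eq_zero ?_ ?_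
    · rw [hW, Submodule.orthogonal_orthogonal]
      exact Submodule.smul_mem _ _ (Submodule.mem_span_singleton_self _)
    · intro w hw
      rw [hW, Submodule.orthogonal_orthogonal] at hw
      obtain ⟨r, rfl⟩ := Submodule.mem_span_singleton.1 hw
      have hn : ‖hT.coordGrad a‖ ^ 2 ≠ 0 := by positivity
      rw [inner_smul_right, real_inner_comm, inner_sub_right, hT.inner_coordGrad,
        hT.coord_linear_sub, hT.coord_self ha, hc, inner_smul_right, real_inner_self_eq_norm_sq,
        inv_mul_cancel₀ hn]
      simp
  have hpos : 0 < (‖hT.coordGrad a‖ ^ 2)⁻¹ := by positivity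
  rw [outwardNormal, hproj, NormedSpace.normalize_smul_of_pos hpos]
  rfl

lemma norm_outwardNormal (hT : IsSimplex T) (hd : 1 ≤ d) {a : E d} (ha : a ∈ T) :
    ‖outwardNormal T a‖ = 1 := by
  rw [hT.outwardNormal_eq hd ha, norm_neg, norm_smul, norm_inv, norm_norm,
    inv_mul_cancel₀ (norm_ne_zero_iff.2 (hT.coordGrad_ne_zero hd ha))]

lemma inner_outwardNormal (hT : IsSimplex T) (hd : 1 ≤ d) {a : E d} (ha : a ∈ T) (v : E d) :
    ⟪v, outwardNormal T a⟫ = -(‖hT.coordGrad a‖⁻¹ * (hT.coord a).linear v) := by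
  rw [hT.outwardNormal_eq hd ha, inner_neg_right, inner_smul_right, real_inner_comm,
    hT.inner_coordGrad]

lemma mem_hyperplane_iff (hT : IsSimplex T) (hd : 1 ≤ d) {a b x : E d} (ha : a ∈ T)
    (hb : b ∈ opp T a) : x ∈ hyperplane b (outwardNormal T a) ↔ hT.coord a x = 0 := by
  have := norm_ne_zero_iff.2 (hT.coordGrad_ne_zero hd ha)
  rw [hyperplane, mem_ofPred_eq, hT.inner_outwardNormal hd ha, hT.coord_linear_sub,
    hT.coord_eq_zero_of_mem_opp hb, sub_zero, neg_eq_zero, mul_eq_zero,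
    or_iff_right (inv_ne_zero this)]

lemma hull_opp_subset_hyperplane (hT : IsSimplex T) (hd : 1 ≤ d) {a b : E d} (ha : a ∈ T)
    (hb : b ∈ opp T a) : hull (opp T a) ⊆ hyperplane b (outwardNormal T a) := fun _ hx =>
  (hT.mem_hyperplane_iff hd ha hb).2 ((hT.mem_hull_opp_iff ha).1 hx).1

end IsSimplex

lemma isCompact_hull (T : Finset (E d)) : IsCompact (hull T) :=
  T.finite_toSet.isCompact_convexHull ℝ

lemma integrableOn_hull {T : Finset (E d)} {f : E d → ℝ} (hf : ContinuousOn f (hull T)) :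
    IntegrableOn f (hull T) :=
  hf.integrableOn_compact (isCompact_hull T)

lemma IsSimplex.surfaceMeasure_facet_lt_top {T : Finset (E d)} (hT : IsSimplex T) (hd : 1 ≤ d)
    {a : E d} (ha : a ∈ T) : (μHE[d - 1] : Measure (E d)) (hull (opp T a)) < ⊤ := by
  obtain ⟨b, hb⟩ := Finset.card_pos.1 (by rw [hT.card_opp ha]; omega : 0 < (opp T a).card)
  exact surfaceMeasure_lt_top_of_isCompact (hT.norm_outwardNormal hd ha) (isCompact_hull _)
    (hT.hull_opp_subset_hyperplane hd ha hb)

lemma IsSimplex.integrableOn_facet {T : Finset (E d)} (hT : IsSimplex T) (hd : 1 ≤ d)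
    {a : E d} (ha : a ∈ T) {f : E d → ℝ} (hf : ContinuousOn f (hull (opp T a))) :
    IntegrableOn f (hull (opp T a)) μHE[d - 1] :=
  hf.integrableOn_of_subset_isCompact (isCompact_hull _) (isCompact_hull _).measurableSet
    Subset.rfl (hT.surfaceMeasure_facet_lt_top hd ha).ne

/-! ### The divergence theorem on a simplex -/

lemma IsSimplex.uniqueDiffOn_hull {T : Finset (E d)} (hT : IsSimplex T) :
    UniqueDiffOn ℝ (hull T) :=
  uniqueDiffOn_convex (convex_convexHull ℝ _) hT.nonempty_interior_hull

namespace IsSimplex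

variable {T : Finset (E d)}

lemma coord_linear_edge (hT : IsSimplex T) {a b : E d} (ha : a ∈ T) (hb : b ∈ T) (e : E d) :
    (hT.coord e).linear (b - a) = (if e = b then 1 else 0) - (if e = a then 1 else 0) := by
  rw [hT.coord_linear_sub]
  have h (v : E d) (hv : v ∈ T) : hT.coord e v = if e = v then 1 else 0 := by
    split_ifs with he
    · rw [he, hT.coord_self hv]
    · exact hT.coord_of_ne hv he
  rw [h b hb, h a ha]

lemma coord_add_smul_edge (hT : IsSimplex T) {a b : E d} (ha : a ∈ T) (hb : b ∈ T) (e y : E d)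
    (s : ℝ) : hT.coord e (y + s • (b - a)) =
      hT.coord e y + s * ((if e = b then 1 else 0) - (if e = a then 1 else 0)) := by
  rw [hT.coord_add, map_smul, hT.coord_linear_edge ha hb, smul_eq_mul]

/-- The line through a point `y` of the hyperplane of the facet opposite to `b`, in the direction
of the edge from `a` to `b`, meets the simplex only if `y` lies in the facet, and then it leaves
the simplex after the time `coord a y`. -/
lemma add_smul_edge_mem_hull_iff (hT : IsSimplex T) {a b : E d} (ha : a ∈ T) (hb : b ∈ T)
    (hab : a ≠ b) {y : E d} (hy : hT.coord b y = 0) (s : ℝ) :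
    y + s • (b - a) ∈ hull T ↔ y ∈ hull (opp T b) ∧ s ∈ Icc 0 (hT.coord a y) := by
  rw [hT.mem_hull_iff, hT.mem_hull_opp_iff hb]
  simp only [hT.coord_add_smul_edge ha hb]
  constructor
  · intro h
    have h1 := h a ha
    have h2 := h b hb
    simp only [hab, hab.symm, if_true, if_false, hy] at h1 h2
    refine ⟨⟨hy, fun e he => ?_⟩, by linarith, by linarith⟩
    have h3 := h e he
    by_cases hea : e = a
    · subst hea; linarith
    · by_cases heb : e = b
      · subst heb; exact hy.ge
      · simpa [hea, heb] using h3
  · rintro ⟨⟨-, h⟩, h0, h1⟩ e he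
    by_cases hea : e = a
    · subst hea; simp only [hab, if_true, if_false]; linarith
    · by_cases heb : e = b
      · subst heb; simp only [hea, hy, if_true, if_false]; linarith
      · simpa [hea, heb] using h e he

/-- The endpoint of the chord through `y` lies in the facet opposite to `a` exactly when `y` lies
in the facet opposite to `b`. -/
lemma projection_mem_hull_opp_iff (hT : IsSimplex T) {a b : E d} (ha : a ∈ T) (hb : b ∈ T)
    (hab : a ≠ b) {y : E d} (hy : hT.coord b y = 0) :
    y + hT.coord a y • (b - a) ∈ hull (opp T a) ↔ y ∈ hull (opp T b) := by
  rw [hT.mem_hull_opp_iff' ha, hT.add_smul_edge_mem_hull_iff ha hb hab hy,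
    hT.coord_add_smul_edge ha hb]
  constructor
  · exact fun h => h.1.1
  · intro h
    refine ⟨⟨h, ((hT.mem_hull_opp_iff hb).1 h).2 a ha, le_rfl⟩, ?_⟩
    simp [hab]

lemma inner_edge_outwardNormal_pos (hT : IsSimplex T) (hd : 1 ≤ d) {a b : E d} (ha : a ∈ T)
    (hb : b ∈ T) (hab : a ≠ b) : 0 < ⟪b - a, outwardNormal T a⟫ := by
  have := norm_pos_iff.2 (hT.coordGrad_ne_zero hd ha)
  rw [hT.inner_outwardNormal hd ha, hT.coord_linear_edge ha hb]
  simpa [hab] using this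

lemma inner_edge_outwardNormal_eq_zero (hT : IsSimplex T) (hd : 1 ≤ d) {a b e : E d} (ha : a ∈ T)
    (hb : b ∈ T) (he : e ∈ T) (hea : e ≠ a) (heb : e ≠ b) :
    ⟪b - a, outwardNormal T e⟫ = 0 := by
  rw [hT.inner_outwardNormal hd he, hT.coord_linear_edge ha hb]
  simp [hea, heb]

/-- The fundamental theorem of calculus on a segment inside the simplex. -/
lemma integral_chord (hT : IsSimplex T) {q : E d → ℝ} (hq : ContDiffOn ℝ 1 q (hull T))
    {y c : E d} {l : ℝ} (hl : 0 ≤ l) (hy : ∀ s ∈ Icc 0 l, y + s • c ∈ hull T) :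
    ∫ s in Icc 0 l, fderivWithin ℝ q (hull T) (y + s • c) c = q (y + l • c) - q y := by
  have hline : ContinuousOn (fun s : ℝ => y + s • c) (Icc 0 l) := by fun_prop
  have hD : ContinuousOn (fun x => fderivWithin ℝ q (hull T) x c) (hull T) :=
    (hq.continuousOn_fderivWithin hT.uniqueDiffOn_hull le_rfl).clm_apply continuousOn_const
  have hint : IntervalIntegrable (fun s : ℝ => fderivWithin ℝ q (hull T) (y + s • c) c)
      volume 0 l := by
    apply ContinuousOn.intervalIntegrable
    rw [uIcc_of_le hl]
    exact hD.comp hline hy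
  have h := intervalIntegral.integral_eq_sub_of_hasDerivAt_of_le
    (f := fun s : ℝ => q (y + s • c)) hl (hq.continuousOn.comp hline hy) (fun s hs => ?_) hint
  · rw [integral_Icc_eq_integral_Ioc, ← intervalIntegral.integral_of_le hl, h]
    simp
  · have h1 := ((hq.differentiableOn one_ne_zero) _
      (hy s (Ioo_subset_Icc_self hs))).hasFDerivWithinAt
    have h2 : HasDerivWithinAt (fun s : ℝ => y + s • c) c (Icc 0 l) s := by
      simpa using (((hasDerivAt_id s).smul_const c).const_add y).hasDerivWithinAt
    exact (h1.comp_hasDerivWithinAt s h2 hy).hasDerivAt (Icc_mem_nhds hs.1 hs.2)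

/-- The divergence theorem on a simplex for the direction of an edge. Lines parallel to the edge
enter the simplex through one of the two facets that do not contain the edge, and leave it through
the other one. -/
lemma integral_fderivWithin_edge (hT : IsSimplex T) (hd : 1 ≤ d) {q : E d → ℝ}
    (hq : ContDiffOn ℝ 1 q (hull T)) {a b : E d} (ha : a ∈ T) (hb : b ∈ T) (hab : a ≠ b) :
    ∫ x in hull T, fderivWithin ℝ q (hull T) x (b - a) =
      ⟪b - a, outwardNormal T a⟫ * ∫ x in hull (opp T a), q x ∂μHE[d - 1] +
      ⟪b - a, outwardNormal T b⟫ * ∫ x in hull (opp T b), q x ∂μHE[d - 1] := by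
  classical
  have ha' : a ∈ opp T b := Finset.mem_erase.2 ⟨hab, ha⟩
  have hb' : b ∈ opp T a := Finset.mem_erase.2 ⟨hab.symm, hb⟩
  have hna := hT.norm_outwardNormal hd ha
  have hnb := hT.norm_outwardNormal hd hb
  have hca := hT.inner_edge_outwardNormal_pos hd ha hb hab
  have hcb : ⟪b - a, outwardNormal T b⟫ < 0 := by
    have := hT.inner_edge_outwardNormal_pos hd hb ha hab.symm
    rw [← neg_sub, inner_neg_left] at this
    linarith
  have hlin : (hT.coord a).linear (b - a) = -1 := by
    rw [hT.coord_linear_edge ha hb]; simp [hab]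
  have hFa := hT.hull_opp_subset_hyperplane hd ha hb'
  have hFb := hT.hull_opp_subset_hyperplane hd hb ha'
  have hmT := (isCompact_hull T).measurableSet
  have hmFa := (isCompact_hull (opp T a)).measurableSet
  have hmFb := (isCompact_hull (opp T b)).measurableSet
  have hHb := (isClosed_hyperplane a (outwardNormal T b)).measurableSet
  have hD : ContinuousOn (fun x => fderivWithin ℝ q (hull T) x (b - a)) (hull T) :=
    (hq.continuousOn_fderivWithin hT.uniqueDiffOn_hull le_rfl).clm_apply continuousOn_const
  have hexit : ∀ y ∈ hull (opp T b), y + hT.coord a y • (b - a) ∈ hull (opp T a) := fun y hy =>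
    (hT.projection_mem_hull_opp_iff ha hb hab ((hT.mem_hull_opp_iff hb).1 hy).1).2 hy
  have hcontFa : ContinuousOn q (hull (opp T a)) := hq.continuousOn.mono (hull_opp_subset T a)
  have hcontFb : ContinuousOn q (hull (opp T b)) := hq.continuousOn.mono (hull_opp_subset T b)
  have hcontexit : ContinuousOn (fun y => q (y + hT.coord a y • (b - a))) (hull (opp T b)) :=
    hcontFa.comp (continuous_id.add ((hT.continuous_coord a).smul continuous_const)).continuousOn
      hexit
  have hproj := integral_comp_projection a b hnb hna hcb.ne hca.ne' (hT.coord a) hlin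
    (fun x hx => (hT.mem_hyperplane_iff hd ha hb').1 hx) (f := (hull (opp T a)).indicator q) (by
      rw [aestronglyMeasurable_indicator_iff hmFa, Measure.restrict_restrict hmFa,
        inter_eq_left.2 hFa]
      exact (hT.integrableOn_facet hd ha hcontFa).aestronglyMeasurable)
  rw [setIntegral_indicator hmFa, inter_eq_right.2 hFa] at hproj
  have hproj' : ∫ y in hyperplane a (outwardNormal T b), (hull (opp T a)).indicator q
      (y + hT.coord a y • (b - a)) ∂μHE[d - 1] =
      ∫ y in hull (opp T b), q (y + hT.coord a y • (b - a)) ∂μHE[d - 1] := by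
    rw [← inter_eq_right.2 hFb, ← setIntegral_indicator hmFb]
    refine setIntegral_congr_fun hHb fun y hy => ?_
    have hyb := (hT.mem_hyperplane_iff hd hb ha').1 hy
    by_cases h : y ∈ hull (opp T b)
    · simp only [indicator_of_mem h, indicator_of_mem (hexit y h)]
    · have h' := mt (hT.projection_mem_hull_opp_iff ha hb hab hyb).1 h
      simp only [indicator_of_notMem h, indicator_of_notMem h']
  rw [hproj'] at hproj
  rw [← integral_indicator hmT, integral_eq_integral_lines a hnb hcb.ne
    ((integrable_indicator_iff hmT).2 (integrableOn_hull hD))]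
  have hinner : ∫ y in hyperplane a (outwardNormal T b),
      (∫ s : ℝ, (hull T).indicator (fun x => fderivWithin ℝ q (hull T) x (b - a))
        (y + s • (b - a))) ∂μHE[d - 1] =
      ∫ y in hull (opp T b), (q (y + hT.coord a y • (b - a)) - q y) ∂μHE[d - 1] := by
    rw [← inter_eq_right.2 hFb, ← setIntegral_indicator hmFb]
    refine setIntegral_congr_fun hHb fun y hy => ?_
    have hyb := (hT.mem_hyperplane_iff hd hb ha').1 hy
    have hmem := hT.add_smul_edge_mem_hull_iff ha hb hab hyb
    by_cases h : y ∈ hull (opp T b)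
    · have hl := ((hT.mem_hull_opp_iff hb).1 h).2 a ha
      simp only [indicator_of_mem h]
      rw [← hT.integral_chord hq hl fun s hs => (hmem s).2 ⟨h, hs⟩,
        ← integral_indicator measurableSet_Icc]
      refine integral_congr_ae (.of_forall fun s => ?_)
      by_cases hs : s ∈ Icc 0 (hT.coord a y)
      · simp only [indicator_of_mem hs, indicator_of_mem ((hmem s).2 ⟨h, hs⟩)]
      · simp only [indicator_of_notMem hs,
          indicator_of_notMem (fun h' => hs ((hmem s).1 h').2)]
    · simp only [indicator_of_notMem h]
      refine integral_eq_zero_of_ae (.of_forall fun s => ?_)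
      exact indicator_of_notMem (fun h' => h ((hmem s).1 h').1) _
  rw [hinner, integral_sub (hT.integrableOn_facet hd hb hcontexit)
    (hT.integrableOn_facet hd hb hcontFb), mul_sub, hproj, abs_of_pos hca, abs_of_neg hcb]
  ring

/-- The divergence theorem on a simplex, for a scalar field and a constant direction. -/
theorem integral_fderivWithin (hT : IsSimplex T) (hd : 1 ≤ d) {q : E d → ℝ}
    (hq : ContDiffOn ℝ 1 q (hull T)) (c : E d) :
    ∫ x in hull T, fderivWithin ℝ q (hull T) x c =
      ∑ a ∈ T, ⟪c, outwardNormal T a⟫ * ∫ x in hull (opp T a), q x ∂μHE[d - 1] := by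
  classical
  have hD (c : E d) : IntegrableOn (fun x => fderivWithin ℝ q (hull T) x c) (hull T) :=
    integrableOn_hull
      ((hq.continuousOn_fderivWithin hT.uniqueDiffOn_hull le_rfl).clm_apply continuousOn_const)
  obtain ⟨a₀, ha₀⟩ := Finset.card_pos.1 (by rw [hT.card]; omega : 0 < T.card)
  -- Both sides are linear in `c`, and the edges from `a₀` span the space.
  obtain ⟨r, rfl⟩ : ∃ r : E d → ℝ, c = ∑ b ∈ T, r b • (b - a₀) := by
    refine ⟨fun b => hT.coord b (a₀ + c), ?_⟩
    simp only [smul_sub, Finset.sum_sub_distrib, hT.sum_coord_smul, ← Finset.sum_smul,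
      hT.sum_coord, one_smul, add_sub_cancel_left]
  have hedge : ∀ b ∈ T, ∫ x in hull T, fderivWithin ℝ q (hull T) x (b - a₀) =
      ∑ a ∈ T, ⟪b - a₀, outwardNormal T a⟫ * ∫ x in hull (opp T a), q x ∂μHE[d - 1] := by
    intro b hb
    rcases eq_or_ne a₀ b with rfl | hab
    · simp
    · rw [hT.integral_fderivWithin_edge hd hq ha₀ hb hab,
        Finset.sum_eq_add_of_mem a₀ b ha₀ hb hab]
      intro e he hne
      rw [hT.inner_edge_outwardNormal_eq_zero hd ha₀ hb he hne.1 hne.2, zero_mul]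
  simp only [map_sum, map_smul, smul_eq_mul, sum_inner, real_inner_smul_left]
  rw [integral_finsetSum _ fun b _ => (hD (b - a₀)).const_mul _]
  simp only [integral_const_mul, Finset.sum_mul]
  rw [Finset.sum_comm]
  refine Finset.sum_congr rfl fun b hb => ?_
  rw [hedge b hb, Finset.mul_sum]
  exact Finset.sum_congr rfl fun a _ => by ring

end IsSimplex

/-! ### Facets of a mesh -/

lemma Mesh.mem_cells {M : Mesh d} {T : Finset (E d)} :
    T ∈ M.cells ↔ T ∈ M.faces ∧ T.card = d + 1 := by
  simp [Mesh.cells]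

lemma Mesh.isSimplex {M : Mesh d} {T : Finset (E d)} (hT : T ∈ M.cells) : IsSimplex T :=
  ⟨M.indep (Mesh.mem_cells.1 hT).1, (Mesh.mem_cells.1 hT).2⟩

lemma Mesh.opp_mem_facets {M : Mesh d} (hd : 1 ≤ d) {T : Finset (E d)} (hT : T ∈ M.cells)
    {a : E d} (ha : a ∈ T) : opp T a ∈ M.facets := by
  classical
  have hc := (M.isSimplex hT).card_opp ha
  have hne : (opp T a).Nonempty := Finset.card_pos.1 (by omega)
  simp only [Mesh.facets, Finset.mem_filter, Finite.mem_toFinset]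
  exact ⟨M.down_closed (Mesh.mem_cells.1 hT).1 (Finset.erase_subset _ _) hne, hc⟩

lemma Mesh.domain_eq (M : Mesh d) : M.domain = ⋃ T ∈ M.cells, hull T := by
  apply Subset.antisymm
  · intro x hx
    obtain ⟨s, hs, hxs⟩ := Geometry.SimplicialComplex.mem_space_iff.1 hx
    obtain ⟨T, hT, hsT, hc⟩ := M.pure s hs
    exact mem_biUnion (Mesh.mem_cells.2 ⟨hT, hc⟩) (convexHull_mono (by exact_mod_cast hsT) hxs)
  · exact iUnion₂_subset fun T hT =>
      Geometry.SimplicialComplex.convexHull_subset_space (Mesh.mem_cells.1 hT).1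

lemma Mesh.hull_subset_domain {M : Mesh d} {T : Finset (E d)} (hT : T ∈ M.cells) :
    hull T ⊆ M.domain := by
  rw [M.domain_eq]
  exact subset_biUnion_of_mem (u := fun T => hull T) hT

lemma Mesh.uniqueDiffOn_domain (M : Mesh d) : UniqueDiffOn ℝ M.domain := by
  intro x hx
  rw [M.domain_eq] at hx
  obtain ⟨T, hT, hxT⟩ := mem_iUnion₂.1 hx
  exact ((M.isSimplex hT).uniqueDiffOn_hull x hxT).mono (Mesh.hull_subset_domain hT)

lemma Mesh.hull_inter_hull_subset {M : Mesh d} {T T' : Finset (E d)} (hT : T ∈ M.cells)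
    (hT' : T' ∈ M.cells) : hull T ∩ hull T' ⊆ convexHull ℝ (T ∩ T' : Set (E d)) :=
  M.inter_subset_convexHull (Mesh.mem_cells.1 hT).1 (Mesh.mem_cells.1 hT').1

lemma eq_insert_opp [DecidableEq (E d)] {T : Finset (E d)} {a : E d} (ha : a ∈ T) :
    T = insert a (opp T a) := by
  ext x
  by_cases h : x = a <;> simp [opp, h, ha]

/-- The centroid of a facet lies in its relative interior. -/
lemma IsSimplex.coord_centroid_opp {T : Finset (E d)} (hT : IsSimplex T) (hd : 1 ≤ d)
    {a : E d} (ha : a ∈ T) : hT.coord a ((opp T a).centroid ℝ id) = 0 ∧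
      ∀ b ∈ opp T a, 0 < hT.coord b ((opp T a).centroid ℝ id) := by
  classical
  have hc := hT.card_opp ha
  have hd' : (0 : ℝ) < d := by exact_mod_cast hd
  have hmem : (opp T a).centroid ℝ id = ∑ v ∈ opp T a, (d : ℝ)⁻¹ • v := by
    rw [Finset.centroid_def, Finset.affineCombination_eq_linear_combination]
    · simp [hc]
    · exact Finset.sum_centroidWeights_eq_one_of_nonempty ℝ _ (Finset.card_pos.1 (by omega))
  have hval (b : E d) : hT.coord b ((opp T a).centroid ℝ id) =
      (d : ℝ)⁻¹ * ∑ v ∈ opp T a, hT.coord b v := by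
    have hw : ∑ v ∈ opp T a, (d : ℝ)⁻¹ = 1 := by
      rw [Finset.sum_const, hc, nsmul_eq_mul, mul_inv_cancel₀ hd'.ne']
    have h1 := (opp T a).map_affineCombination id (fun _ => (d : ℝ)⁻¹) hw (hT.coord b)
    rw [Finset.affineCombination_eq_linear_combination _ _ _ hw,
      Finset.affineCombination_eq_linear_combination _ _ _ hw] at h1
    simp only [id, Function.comp, smul_eq_mul] at h1
    rw [hmem, h1, Finset.mul_sum]
  constructor
  · rw [hval, Finset.sum_eq_zero fun v hv => hT.coord_eq_zero_of_mem_opp hv, mul_zero]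
  · intro b hb
    rw [hval, Finset.sum_eq_single_of_mem b hb fun v hv hvb =>
      hT.coord_of_ne (Finset.mem_of_mem_erase hv) hvb.symm,
      hT.coord_self (Finset.mem_of_mem_erase hb), mul_one]
    positivity

/-- For two simplices with a common facet, the barycentric coordinates which vanish on it are
proportional. -/
lemma IsSimplex.coord_eq_smul_coord {T T' : Finset (E d)} (hT : IsSimplex T) (hT' : IsSimplex T')
    {a a' : E d} (ha : a ∈ T) (h : opp T a = opp T' a') (x : E d) :
    hT'.coord a' x = hT'.coord a' a * hT.coord a x := by
  classical
  have hx := T.map_affineCombination id (fun v => hT.coord v x) (hT.sum_coord x) (hT'.coord a')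
  rw [Finset.affineCombination_eq_linear_combination _ _ _ (hT.sum_coord x),
    Finset.affineCombination_eq_linear_combination _ _ _ (hT.sum_coord x)] at hx
  simp only [id, Function.comp, smul_eq_mul, hT.sum_coord_smul] at hx
  rw [hx, ← Finset.add_sum_erase _ _ ha, Finset.sum_eq_zero, add_zero, mul_comm]
  intro v hv
  rw [hT'.coord_eq_zero_of_mem_opp (by rw [← h]; exact hv), mul_zero]

/-- Two different cells with a common facet lie on different sides of it. -/
lemma Mesh.coord_neg_of_opp_eq {M : Mesh d} (hd : 1 ≤ d) {T T' : Finset (E d)} (hT : T ∈ M.cells)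
    (hT' : T' ∈ M.cells) {a a' : E d} (ha : a ∈ T) (ha' : a' ∈ T') (h : opp T a = opp T' a')
    (hne : T ≠ T') : (M.isSimplex hT').coord a' a < 0 := by
  classical
  have sT := M.isSimplex hT
  have sT' := M.isSimplex hT'
  by_contra! hnonneg
  have haT' : a ∉ T' := by
    intro haT'
    apply hne
    refine Finset.eq_of_subset_of_card_le ?_ (by rw [sT.card, sT'.card])
    rw [eq_insert_opp ha, h]
    exact Finset.insert_subset haT' (Finset.erase_subset _ _)
  obtain ⟨hm0, hmpos⟩ := sT.coord_centroid_opp hd ha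
  obtain ⟨hm0', hmpos'⟩ := sT'.coord_centroid_opp hd ha'
  rw [← h] at hm0' hmpos'
  set m := (opp T a).centroid ℝ id
  -- The points `m + ε (a - m)` with small `ε > 0` belong to both cells, but not to the facet.
  have hev : ∀ᶠ ε in 𝓝[>] (0 : ℝ), ∀ b ∈ opp T a, 0 < sT'.coord b (m + ε • (a - m)) := by
    rw [Filter.eventually_all_finset]
    intro b hb
    have hcont : Continuous fun ε : ℝ => sT'.coord b (m + ε • (a - m)) :=
      (sT'.continuous_coord b).comp (by fun_prop)
    have h0 : 0 < sT'.coord b (m + (0 : ℝ) • (a - m)) := by simpa using hmpos' b hb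
    exact (hcont.tendsto 0).eventually (lt_mem_nhds h0) |>.filter_mono nhdsWithin_le_nhds
  obtain ⟨ε, hε, hε0, hε1⟩ := (hev.and (Ioc_mem_nhdsGT one_pos)).exists
  have hline (b : E d) : sT.coord b (m + ε • (a - m)) =
      (1 - ε) * sT.coord b m + ε * sT.coord b a := by
    rw [sT.coord_add, map_smul, sT.coord_linear_sub, smul_eq_mul]; ring
  have hmemT : m + ε • (a - m) ∈ hull T := by
    rw [sT.mem_hull_iff]
    intro b hb
    rw [hline]
    by_cases hba : b = a
    · subst hba
      rw [hm0, sT.coord_self ha]; linarith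
    · rw [sT.coord_of_ne ha hba]
      have := hmpos b (Finset.mem_erase.2 ⟨hba, hb⟩)
      nlinarith
  have hmemT' : m + ε • (a - m) ∈ hull T' := by
    rw [sT'.mem_hull_iff]
    intro b hb
    by_cases hba : b = a'
    · subst hba
      rw [sT.coord_eq_smul_coord sT' ha h, hline, hm0, sT.coord_self ha]
      have := mul_nonneg hnonneg hε0.le
      linarith
    · exact (hε b (by rw [h]; exact Finset.mem_erase.2 ⟨hba, hb⟩)).le
  have hF : m + ε • (a - m) ∈ hull (opp T a) := by
    refine convexHull_mono ?_ (Mesh.hull_inter_hull_subset hT hT' ⟨hmemT, hmemT'⟩)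
    rintro v ⟨hv, hv'⟩
    exact Finset.mem_coe.2 (Finset.mem_erase.2 ⟨fun hva => haT' (hva ▸ hv'), hv⟩)
  have := ((sT.mem_hull_opp_iff ha).1 hF).1
  rw [hline, hm0, sT.coord_self ha] at this
  linarith

/-- The outward normals of two different cells on a common facet are opposite. -/
lemma Mesh.outwardNormal_eq_neg {M : Mesh d} (hd : 1 ≤ d) {T T' : Finset (E d)} (hT : T ∈ M.cells)
    (hT' : T' ∈ M.cells) {a a' : E d} (ha : a ∈ T) (ha' : a' ∈ T') (h : opp T a = opp T' a')
    (hne : T ≠ T') : outwardNormal T' a' = -outwardNormal T a := by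
  have sT := M.isSimplex hT
  have sT' := M.isSimplex hT'
  have hneg : sT'.coord a' a < 0 := M.coord_neg_of_opp_eq hd hT hT' ha ha' h hne
  have hg : sT'.coordGrad a' = sT'.coord a' a • sT.coordGrad a := by
    refine ext_inner_right ℝ fun v => ?_
    rw [sT'.inner_coordGrad, real_inner_smul_left, sT.inner_coordGrad]
    have h1 := sT'.coord_linear_sub a' v 0
    have h2 := sT.coord_linear_sub a v 0
    rw [sub_zero] at h1 h2
    rw [h1, h2, sT.coord_eq_smul_coord sT' ha h v, sT.coord_eq_smul_coord sT' ha h 0]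
    ring
  rw [sT'.outwardNormal_eq hd ha', sT.outwardNormal_eq hd ha, hg, norm_smul, mul_inv, smul_smul,
    Real.norm_of_nonpos hneg.le]
  have : (-(sT'.coord a' a))⁻¹ * ‖sT.coordGrad a‖⁻¹ * sT'.coord a' a = -‖sT.coordGrad a‖⁻¹ := by
    field_simp [hneg.ne]
  rw [this, neg_smul]

/-- A facet that meets the interior of the domain belongs to a second cell. -/
lemma Mesh.exists_opp_eq_of_not_subset_frontier {M : Mesh d} (hd : 1 ≤ d) {T : Finset (E d)}
    (hT : T ∈ M.cells) {a : E d} (ha : a ∈ T) (hF : ¬ hull (opp T a) ⊆ frontier M.domain) :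
    ∃ T' ∈ M.cells, ∃ a' ∈ T', opp T' a' = opp T a ∧ T' ≠ T := by
  classical
  have sT := M.isSimplex hT
  obtain ⟨x, hxF, hx⟩ := not_subset.1 hF
  have hxint : x ∈ interior M.domain := by
    by_contra hxint
    exact hx ⟨subset_closure (Mesh.hull_subset_domain hT (hull_opp_subset T a hxF)), hxint⟩
  obtain ⟨hm0, hmpos⟩ := sT.coord_centroid_opp hd ha
  set m := (opp T a).centroid ℝ id
  obtain ⟨hx0, hxnonneg⟩ := (sT.mem_hull_opp_iff ha).1 hxF
  -- Move `x` into the relative interior of the facet, staying in the interior of the domain.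
  obtain ⟨y, hyint, hy0, hypos⟩ : ∃ y ∈ interior M.domain, sT.coord a y = 0 ∧
      ∀ b ∈ opp T a, 0 < sT.coord b y := by
    have hcont : Continuous fun δ : ℝ => x + δ • (m - x) := by fun_prop
    have hev : ∀ᶠ δ in 𝓝[>] (0 : ℝ), x + δ • (m - x) ∈ interior M.domain :=
      ((hcont.tendsto 0).eventually
        (by simpa using isOpen_interior.mem_nhds hxint)).filter_mono nhdsWithin_le_nhds
    obtain ⟨δ, hδ, hδ0, hδ1⟩ := (hev.and (Ioc_mem_nhdsGT one_pos)).exists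
    have hline (b : E d) : sT.coord b (x + δ • (m - x)) =
        (1 - δ) * sT.coord b x + δ * sT.coord b m := by
      rw [sT.coord_add, map_smul, sT.coord_linear_sub, smul_eq_mul]; ring
    refine ⟨_, hδ, by rw [hline, hx0, hm0]; ring, fun b hb => ?_⟩
    rw [hline]
    have h1 := mul_nonneg (sub_nonneg.2 hδ1) (hxnonneg b (Finset.mem_of_mem_erase hb))
    have h2 := mul_pos hδ0 (hmpos b hb)
    linarith
  -- Points beyond the facet lie in finitely many cells, so some cell contains points arbitrarily
  -- close to `y`, and then `y` itself.
  have hcont : Continuous fun ε : ℝ => y + ε • (m - a) := by fun_prop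
  have hev : ∀ᶠ ε in 𝓝[>] (0 : ℝ), y + ε • (m - a) ∈ M.domain :=
    ((hcont.tendsto 0).eventually
      (by simpa using mem_interior_iff_mem_nhds.1 hyint)).filter_mono nhdsWithin_le_nhds
  obtain ⟨T', hT', hfreq⟩ : ∃ T' ∈ M.cells, ∃ᶠ ε in 𝓝[>] (0 : ℝ), y + ε • (m - a) ∈ hull T' := by
    by_contra! hcon
    have hnot : ∀ᶠ ε in 𝓝[>] (0 : ℝ), ∀ T' ∈ M.cells, y + ε • (m - a) ∉ hull T' :=
      (Filter.eventually_all_finset _).2 fun T' hT' => hcon T' hT'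
    obtain ⟨ε, h1, h2⟩ := (hev.and hnot).exists
    rw [M.domain_eq] at h1
    obtain ⟨T', hT', h3⟩ := mem_iUnion₂.1 h1
    exact h2 T' hT' h3
  have sT' := M.isSimplex hT'
  have hyT' : y ∈ hull T' := by
    refine (isCompact_hull T').isClosed.mem_of_frequently_of_tendsto hfreq ?_
    have := hcont.tendsto 0
    simp only [zero_smul, add_zero] at this
    exact this.mono_left nhdsWithin_le_nhds
  have hyT : y ∈ hull T := sT.mem_hull_iff.2 fun b hb => by
    by_cases hba : b = a
    · rw [hba, hy0]
    · exact (hypos b (Finset.mem_erase.2 ⟨hba, hb⟩)).le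
  have hsub : opp T a ⊆ T' := by
    intro b hb
    by_contra hbT'
    have : y ∈ hull (opp T b) := by
      refine convexHull_mono ?_ (Mesh.hull_inter_hull_subset hT hT' ⟨hyT, hyT'⟩)
      rintro v ⟨hv, hv'⟩
      exact Finset.mem_coe.2 (Finset.mem_erase.2 ⟨fun hvb => hbT' (hvb ▸ hv'), hv⟩)
    have h0 := ((sT.mem_hull_opp_iff (Finset.mem_of_mem_erase hb)).1 this).1
    exact (hypos b hb).ne' h0
  obtain ⟨a', ha'T', ha'⟩ : ∃ a' ∈ T', a' ∉ opp T a := by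
    by_contra! hcon
    have := Finset.card_le_card hcon
    rw [sT'.card, sT.card_opp ha] at this
    omega
  refine ⟨T', hT', a', ha'T', ?_, ?_⟩
  · refine (Finset.eq_of_subset_of_card_le ?_ (by rw [sT.card_opp ha, sT'.card_opp ha'T'])).symm
    exact fun b hb => Finset.mem_erase.2 ⟨fun hba => ha' (hba ▸ hb), hsub hb⟩
  · rintro rfl
    obtain ⟨ε, hε, hε0⟩ := (hfreq.and_eventually self_mem_nhdsWithin).exists
    have h1 := sT.mem_hull_iff.1 hε a ha
    rw [sT.coord_add, map_smul, sT.coord_linear_sub, hy0, hm0, sT.coord_self ha, smul_eq_mul] at h1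
    have : (0 : ℝ) < ε := hε0
    linarith

open Classical in
/-- The normal fluxes of a field that is single-valued on the facets cancel on the interior facets:
each of those belongs to exactly two cells, whose outward normals are opposite. -/
lemma Mesh.facetIntegral_eq_boundary {M : Mesh d} (hd : 1 ≤ d)
    (w : Finset (E d) → E d → E d) :
    facetIntegral M (fun _ F n x => ⟪w F x, n⟫) =
      ∑ T ∈ M.cells, ∑ a ∈ T with hull (opp T a) ⊆ frontier M.domain,
        ∫ x in hull (opp T a), ⟪w (opp T a) x, outwardNormal T a⟫ ∂μHE[d - 1] := by
  have hsplit : facetIntegral M (fun _ F n x => ⟪w F x, n⟫) =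
      (∑ T ∈ M.cells, ∑ a ∈ T with hull (opp T a) ⊆ frontier M.domain,
        ∫ x in hull (opp T a), ⟪w (opp T a) x, outwardNormal T a⟫ ∂μHE[d - 1]) +
      ∑ T ∈ M.cells, ∑ a ∈ T with ¬ hull (opp T a) ⊆ frontier M.domain,
        ∫ x in hull (opp T a), ⟪w (opp T a) x, outwardNormal T a⟫ ∂μHE[d - 1] := by
    rw [← Finset.sum_add_distrib]
    exact Finset.sum_congr rfl fun T _ => (Finset.sum_filter_add_sum_filter_not _ _ _).symm
  rw [hsplit, add_eq_left, Finset.sum_sigma']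
  set s := M.cells.sigma fun T => T.filter fun a => ¬ hull (opp T a) ⊆ frontier M.domain
  have hs (z : Σ _ : Finset (E d), E d) : z ∈ s ↔ z.1 ∈ M.cells ∧ z.2 ∈ z.1 ∧
      ¬ hull (opp z.1 z.2) ⊆ frontier M.domain := by simp [s]
  rw [← Finset.sum_fiberwise_of_maps_to (t := s.image fun z => opp z.1 z.2)
    (g := fun z => opp z.1 z.2) fun z hz => Finset.mem_image_of_mem _ hz]
  refine Finset.sum_eq_zero fun F hF => ?_
  obtain ⟨⟨T, a⟩, hTa, rfl⟩ := Finset.mem_image.1 hF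
  obtain ⟨hT, ha, hfr⟩ := (hs _).1 hTa
  obtain ⟨T', hT', a', ha', hopp, hne⟩ := M.exists_opp_eq_of_not_subset_frontier hd hT ha hfr
  simp only at hopp hne hT ha hfr
  have hcell {T₁ T₂ : Finset (E d)} {a₁ a₂ : E d} (h₁ : T₁ ∈ M.cells) (h₂ : T₂ ∈ M.cells)
      (ha₁ : a₁ ∈ T₁) (ha₂ : a₂ ∈ T₂) (h : opp T₁ a₁ = opp T₂ a₂) (hT : T₁ = T₂) : a₁ = a₂ := by
    subst hT
    by_contra hab
    have : a₁ ∈ opp T₁ a₂ := Finset.mem_erase.2 ⟨hab, ha₁⟩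
    rw [← h] at this
    exact Finset.notMem_erase _ _ this
  have hpair : s.filter (fun z => opp z.1 z.2 = opp T a) = {⟨T, a⟩, ⟨T', a'⟩} := by
    ext ⟨T₁, a₁⟩
    simp only [Finset.mem_filter, hs, Finset.mem_insert, Finset.mem_singleton]
    constructor
    · rintro ⟨⟨hT₁, ha₁, -⟩, h₁⟩
      by_cases h : T₁ = T
      · left
        obtain rfl := hcell hT₁ hT ha₁ ha h₁ h
        rw [h]
      · by_cases h' : T₁ = T'
        · right
          obtain rfl := hcell hT₁ hT' ha₁ ha' (h₁.trans hopp.symm) h'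
          rw [h']
        · -- Three pairwise opposite unit vectors do not exist.
          exfalso
          have e₁ := M.outwardNormal_eq_neg hd hT hT₁ ha ha₁ h₁.symm (Ne.symm h)
          have e₂ := M.outwardNormal_eq_neg hd hT hT' ha ha' hopp.symm hne.symm
          have e₃ := M.outwardNormal_eq_neg hd hT' hT₁ ha' ha₁ (hopp.trans h₁.symm) (Ne.symm h')
          rw [e₁, e₂, neg_neg] at e₃
          have := congrArg (fun v => ⟪v, outwardNormal T a⟫) e₃
          simp only [inner_neg_left, real_inner_self_eq_norm_sq,
            (M.isSimplex hT).norm_outwardNormal hd ha] at this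
          norm_num at this
    · rintro (h | h)
      · obtain ⟨rfl, h₂⟩ := Sigma.mk.inj_iff.1 h
        obtain rfl := eq_of_heq h₂
        exact ⟨⟨hT, ha, hfr⟩, rfl⟩
      · obtain ⟨rfl, h₂⟩ := Sigma.mk.inj_iff.1 h
        obtain rfl := eq_of_heq h₂
        exact ⟨⟨hT', ha', by rwa [hopp]⟩, hopp⟩
  rw [hpair, Finset.sum_pair (fun h => hne (Sigma.mk.inj_iff.1 h).1.symm)]
  simp only [hopp, M.outwardNormal_eq_neg hd hT hT' ha ha' hopp.symm hne.symm, inner_neg_right,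
    integral_neg, add_neg_cancel]

/-! ### Tensor calculus and integration by parts -/

lemma inner_eq_sum (v w : E d) : ⟪v, w⟫ = ∑ i, v i * w i := by
  simp [PiLp.inner_apply, mul_comm]

lemma ddot_outer (A : Matrix (Fin d) (Fin d) ℝ) (v n : E d) :
    ddot A (outer v n) = ⟪matVec Aᵀ v, n⟫ := by
  simp only [ddot, outer, inner_eq_sum, matVec, Matrix.of_apply, Matrix.transpose_apply,
    Finset.sum_mul]
  rw [Finset.sum_comm]
  simp only [mul_assoc]

lemma ddot_outer_eq_inner_matVec (A : Matrix (Fin d) (Fin d) ℝ) (v n : E d) :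
    ddot A (outer v n) = ⟪matVec A n, v⟫ := by
  simp only [ddot, outer, inner_eq_sum, matVec, Matrix.of_apply, Finset.sum_mul]
  exact Finset.sum_congr rfl fun i _ => Finset.sum_congr rfl fun j _ => by ring

lemma ddot_outer_outer (a b v n : E d) : ddot (outer a b) (outer v n) = ⟪b, n⟫ * ⟪a, v⟫ := by
  rw [ddot_outer_eq_inner_matVec]
  simp only [inner_eq_sum, matVec, outer, Matrix.of_apply, Finset.sum_mul, Finset.mul_sum]
  exact Finset.sum_congr rfl fun i _ => Finset.sum_congr rfl fun j _ => by ring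

lemma ddot_smul_one_outer (r : ℝ) (v n : E d) :
    ddot (r • (1 : Matrix (Fin d) (Fin d) ℝ)) (outer v n) = r * ⟪n, v⟫ := by
  rw [ddot_outer_eq_inner_matVec]
  simp [inner_eq_sum, matVec, Matrix.one_apply, Finset.mul_sum, mul_assoc]

@[simp]
lemma outer_zero_left (b : E d) : outer 0 b = 0 := by
  ext i j; simp [outer]

@[simp]
lemma ddot_zero_left (B : Matrix (Fin d) (Fin d) ℝ) : ddot 0 B = 0 := by
  simp [ddot]

lemma ddot_add_left (A B C : Matrix (Fin d) (Fin d) ℝ) :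
    ddot (A + B) C = ddot A C + ddot B C := by
  simp [ddot, add_mul, Finset.sum_add_distrib]

lemma ddot_sub_left (A B C : Matrix (Fin d) (Fin d) ℝ) :
    ddot (A - B) C = ddot A C - ddot B C := by
  simp [ddot, sub_mul, Finset.sum_sub_distrib]

lemma transpose_symGrad (S : Set (E d)) (w : E d → E d) (x : E d) :
    (symGrad S w x)ᵀ = symGrad S w x := by
  simp [symGrad, add_comm]

/-- Contraction with a symmetric matrix ignores the antisymmetric part of the gradient. -/
lemma ddot_symGrad {A : Matrix (Fin d) (Fin d) ℝ} (hA : Aᵀ = A) (S : Set (E d))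
    (w : E d → E d) (x : E d) : ddot A (symGrad S w x) = ddot A (grad S w x) := by
  have h : ddot A (grad S w x)ᵀ = ddot A (grad S w x) := by
    rw [ddot, ddot, Finset.sum_comm]
    refine Finset.sum_congr rfl fun i _ => Finset.sum_congr rfl fun j _ => ?_
    rw [← Matrix.transpose_apply A, hA, Matrix.transpose_apply]
  have h' : ddot A (symGrad S w x) =
      (1 / 2) * (ddot A (grad S w x) + ddot A (grad S w x)ᵀ) := by
    simp only [ddot, symGrad, Matrix.smul_apply, Matrix.add_apply, smul_eq_mul, Finset.mul_sum,
      ← Finset.sum_add_distrib]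
    exact Finset.sum_congr rfl fun i _ => Finset.sum_congr rfl fun j _ => by ring
  rw [h', h]
  ring

lemma IsPolyOn.contDiffOn {k : ℕ} {S : Set (E d)} {q : E d → ℝ} (hq : IsPolyOn k S q) :
    ContDiffOn ℝ 1 q S := by
  obtain ⟨P, -, hP⟩ := hq
  refine ContDiffOn.congr (ContDiff.contDiffOn ?_) hP
  clear hP
  induction P using MvPolynomial.induction_on with
  | C a => simpa using contDiff_const
  | add p q hp hq => simpa using hp.add hq
  | mul_X p i hp => simpa using hp.mul (contDiff_euclidean.1 contDiff_id i)

lemma contDiffOn_of_isPolyOn {k : ℕ} {S : Set (E d)} {v : E d → E d}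
    (hv : ∀ i, IsPolyOn k S fun x => v x i) : ContDiffOn ℝ 1 v S :=
  contDiffOn_euclidean.2 fun i => (hv i).contDiffOn

lemma grad_apply {S : Set (E d)} (hS : UniqueDiffOn ℝ S) {w : E d → E d} {x : E d} (hx : x ∈ S)
    (hw : DifferentiableOn ℝ w S) (i j : Fin d) :
    grad S w x i j = fderivWithin ℝ (fun y => w y i) S x (EuclideanSpace.single j 1) := by
  have h := (EuclideanSpace.proj (𝕜 := ℝ) i).hasFDerivAt.comp_hasFDerivWithinAt x
    (hw x hx).hasFDerivWithinAt
  have h' := h.fderivWithin (hS x hx)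
  change _ = (fderivWithin ℝ ((EuclideanSpace.proj (𝕜 := ℝ) i) ∘ w) S x) _
  rw [h']
  rfl

lemma grad_subset {S S' : Set (E d)} (hSS' : S ⊆ S') (hS : UniqueDiffOn ℝ S) {w : E d → E d}
    (hw : DifferentiableOn ℝ w S') {x : E d} (hx : x ∈ S) : grad S w x = grad S' w x := by
  simp only [grad, fderivWithin_subset hSS' (hS x hx) (hw x (hSS' hx))]

lemma symGrad_subset {S S' : Set (E d)} (hSS' : S ⊆ S') (hS : UniqueDiffOn ℝ S) {w : E d → E d}
    (hw : DifferentiableOn ℝ w S') {x : E d} (hx : x ∈ S) : symGrad S w x = symGrad S' w x := by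
  rw [symGrad, symGrad, grad_subset hSS' hS hw hx]

lemma tensorDiv_subset {S S' : Set (E d)} (hSS' : S ⊆ S') (hS : UniqueDiffOn ℝ S)
    {A : E d → Matrix (Fin d) (Fin d) ℝ} (hA : ∀ i j, DifferentiableOn ℝ (fun y => A y i j) S')
    {x : E d} (hx : x ∈ S) : tensorDiv S A x = tensorDiv S' A x := by
  simp only [tensorDiv, fderivWithin_subset hSS' (hS x hx) (hA _ _ x (hSS' hx))]

lemma tensorDiv_smul_one {S : Set (E d)} (hS : UniqueDiffOn ℝ S) {q : E d → ℝ} (r : ℝ)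
    (hq : DifferentiableOn ℝ q S) {x : E d} (hx : x ∈ S) :
    tensorDiv S (fun y => (r * q y) • (1 : Matrix (Fin d) (Fin d) ℝ)) x =
      r • scalarGrad S q x := by
  ext i
  simp only [tensorDiv, scalarGrad, PiLp.smul_apply, smul_eq_mul]
  rw [Finset.sum_eq_single i]
  · simp only [Matrix.smul_apply, Matrix.one_apply_eq, smul_eq_mul, mul_one]
    rw [fderivWithin_const_mul (hS x hx) (hq x hx)]
    rfl
  · intro j _ hji
    simp [Matrix.one_apply_ne hji.symm]
  · simp

lemma contDiffOn_grad {S : Set (E d)} (hS : UniqueDiffOn ℝ S) {w : E d → E d}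
    (hw : ContDiffOn ℝ 2 w S) (i j : Fin d) : ContDiffOn ℝ 1 (fun x => grad S w x i j) S :=
  contDiffOn_euclidean.1 ((hw.fderivWithin hS (by norm_num)).clm_apply contDiffOn_const) i

lemma contDiffOn_symGrad {S : Set (E d)} (hS : UniqueDiffOn ℝ S) {w : E d → E d}
    (hw : ContDiffOn ℝ 2 w S) (i j : Fin d) :
    ContDiffOn ℝ 1 (fun x => symGrad S w x i j) S :=
  contDiffOn_const.mul ((contDiffOn_grad hS hw i j).add (contDiffOn_grad hS hw j i))

lemma continuousOn_ddot {S : Set (E d)} {A B : E d → Matrix (Fin d) (Fin d) ℝ}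
    (hA : ∀ i j, ContinuousOn (fun x => A x i j) S)
    (hB : ∀ i j, ContinuousOn (fun x => B x i j) S) :
    ContinuousOn (fun x => ddot (A x) (B x)) S :=
  continuousOn_finsetSum _ fun i _ => continuousOn_finsetSum _ fun j _ => (hA i j).mul (hB i j)

lemma continuousOn_tensorDiv {S : Set (E d)} (hS : UniqueDiffOn ℝ S)
    {A : E d → Matrix (Fin d) (Fin d) ℝ} (hA : ∀ i j, ContDiffOn ℝ 1 (fun y => A y i j) S) :
    ContinuousOn (tensorDiv S A) S := by
  refine (PiLp.continuous_toLp 2 _).comp_continuousOn (continuousOn_pi.2 fun i => ?_)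
  exact continuousOn_finsetSum _ fun j _ =>
    ((hA i j).continuousOn_fderivWithin hS le_rfl).clm_apply continuousOn_const

lemma continuousOn_grad {S : Set (E d)} (hS : UniqueDiffOn ℝ S) {w : E d → E d}
    (hw : ContDiffOn ℝ 1 w S) (i j : Fin d) : ContinuousOn (fun x => grad S w x i j) S :=
  continuousOn_pi.1 ((PiLp.continuous_ofLp 2 _).comp_continuousOn
    ((hw.continuousOn_fderivWithin hS le_rfl).clm_apply
      (continuousOn_const (c := EuclideanSpace.single j 1)))) i

/-- Integration by parts on a simplex for a tensor field and a vector field. -/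
theorem IsSimplex.sum_facetIntegral_ddot {T : Finset (E d)} (hT : IsSimplex T) (hd : 1 ≤ d)
    {A : E d → Matrix (Fin d) (Fin d) ℝ} {v : E d → E d}
    (hA : ∀ i j, ContDiffOn ℝ 1 (fun y => A y i j) (hull T)) (hv : ContDiffOn ℝ 1 v (hull T)) :
    ∑ a ∈ T, ∫ x in hull (opp T a), ddot (A x) (outer (v x) (outwardNormal T a)) ∂μHE[d - 1] =
      (∫ x in hull T, ⟪tensorDiv (hull T) A x, v x⟫) +
        ∫ x in hull T, ddot (A x) (grad (hull T) v x) := by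
  have hS := hT.uniqueDiffOn_hull
  have hvi := contDiffOn_euclidean.1 hv
  -- The divergence theorem applies to the components `q j` of `Aᵀ v`.
  let q : Fin d → E d → ℝ := fun j x => ∑ i, A x i j * v x i
  have hq (j : Fin d) : ContDiffOn ℝ 1 (q j) (hull T) :=
    ContDiffOn.sum fun i _ => (hA i j).mul (hvi i)
  have hder : ∀ x ∈ hull T, ∑ j, fderivWithin ℝ (q j) (hull T) x (EuclideanSpace.single j 1) =
      ⟪tensorDiv (hull T) A x, v x⟫ + ddot (A x) (grad (hull T) v x) := by
    intro x hx
    have hj (j : Fin d) : fderivWithin ℝ (q j) (hull T) x (EuclideanSpace.single j 1) =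
        ∑ i, (fderivWithin ℝ (fun y => A y i j) (hull T) x (EuclideanSpace.single j 1) * v x i +
          A x i j * grad (hull T) v x i j) := by
      have h : HasFDerivWithinAt (q j) (∑ i, (A x i j • fderivWithin ℝ (fun y => v y i) (hull T) x
          + v x i • fderivWithin ℝ (fun y => A y i j) (hull T) x)) (hull T) x :=
        HasFDerivWithinAt.fun_sum fun i _ =>
          (((hA i j).differentiableOn one_ne_zero) x hx).hasFDerivWithinAt.mul
            (((hvi i).differentiableOn one_ne_zero) x hx).hasFDerivWithinAt
      rw [h.fderivWithin (hS x hx), sum_apply]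
      refine Finset.sum_congr rfl fun i _ => ?_
      rw [grad_apply hS hx (hv.differentiableOn one_ne_zero)]
      simp only [add_apply, smul_apply, smul_eq_mul]
      ring
    simp only [hj, Finset.sum_add_distrib, inner_eq_sum, tensorDiv, ddot, Finset.sum_mul]
    congr 1
    · exact Finset.sum_comm
    · exact Finset.sum_comm
  have hintD (j : Fin d) : IntegrableOn
      (fun x => fderivWithin ℝ (q j) (hull T) x (EuclideanSpace.single j 1)) (hull T) :=
    integrableOn_hull
      (((hq j).continuousOn_fderivWithin hS le_rfl).clm_apply continuousOn_const)
  rw [← integral_add, ← setIntegral_congr_fun (isCompact_hull T).measurableSet hder,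
    integral_finsetSum _ fun j _ => hintD j]
  · simp only [hT.integral_fderivWithin hd (hq _)]
    rw [Finset.sum_comm]
    refine Finset.sum_congr rfl fun a ha => ?_
    simp only [← integral_const_mul]
    rw [← integral_finsetSum _ fun j _ => (hT.integrableOn_facet hd ha
      ((hq j).continuousOn.mono (hull_opp_subset T a))).const_mul _]
    refine integral_congr_ae (.of_forall fun x => ?_)
    simp only [ddot, outer, Matrix.of_apply, EuclideanSpace.inner_single_left, map_one, one_mul, q,
      Finset.mul_sum]
    rw [Finset.sum_comm]
    exact Finset.sum_congr rfl fun j _ => Finset.sum_congr rfl fun i _ => by ring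
  · exact integrableOn_hull ((continuousOn_tensorDiv hS hA).inner hv.continuousOn)
  · exact integrableOn_hull (continuousOn_ddot (fun i j => (hA i j).continuousOn)
      (continuousOn_grad hS hv))

/-! ### Consistency of the method -/

lemma ae_mem_interior_hull (T : Finset (E d)) :
    ∀ᵐ x ∂(volume.restrict (hull T)), x ∈ interior (hull T) := by
  have h0 := (convex_convexHull ℝ (T : Set (E d))).addHaar_frontier volume
  rw [ae_restrict_iff' (isCompact_hull T).measurableSet]
  filter_upwards [measure_eq_zero_iff_ae_notMem.1 h0] with x hx hxT
  by_contra h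
  exact hx ⟨subset_closure hxT, h⟩

section Solution

variable {M : Mesh d} {D : RANSData M} {u : ℝ → E d → E d} {p : ℝ → E d → ℝ}

/-- The viscous stress tensor `2 (ν + ν_T) ∇^S u` of a velocity field on the domain. -/
def viscousStress (D : RANSData M) (u : ℝ → E d → E d) (t : ℝ) (x : E d) :
    Matrix (Fin d) (Fin d) ℝ :=
  (2 * D.visc t x) • symGrad M.domain (u t) x

lemma transpose_viscousStress (t : ℝ) (x : E d) :
    (viscousStress D u t x)ᵀ = viscousStress D u t x := by
  rw [viscousStress, Matrix.transpose_smul, transpose_symGrad]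

theorem continuityConservativity (hd : 1 ≤ d) (k : ℕ) (w : E d → E d) :
    ContinuityConservativity M D k (fun _ => w) (fun _ => w) := by
  classical
  intro q _
  have h := M.facetIntegral_eq_boundary hd fun F x => (1 / D.ρ * q F x) • w x
  have hinner (F : Finset (E d)) (x n : E d) :
      1 / D.ρ * ⟪w x, n⟫ * q F x = ⟪(1 / D.ρ * q F x) • w x, n⟫ := by
    rw [real_inner_smul_left]; ring
  simp only [hinner]
  rw [h, boundaryIntegral, sub_eq_zero]
  refine Finset.sum_congr rfl fun T _ => Finset.sum_congr ?_ fun a ha => ?_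
  · ext a; simp
  · rw [inter_eq_left.2 (Finset.mem_filter.1 ha).2]

namespace IsSmoothSolution

variable (hsol : IsSmoothSolution M D u p) {t : ℝ} (ht : 0 < t)
include hsol ht

lemma differentiableOn_velocity : DifferentiableOn ℝ (u t) M.domain :=
  (hsol.smooth_velocity t ht).differentiableOn two_ne_zero

lemma contDiffOn_convection (i j : Fin d) :
    ContDiffOn ℝ 1 (fun x => outer (u t x) (u t x) i j) M.domain := by
  have h := contDiffOn_euclidean.1 ((hsol.smooth_velocity t ht).of_le one_le_two)
  exact (h i).mul (h j)

lemma contDiffOn_pressure (i j : Fin d) :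
    ContDiffOn ℝ 1 (fun x => ((1 / D.ρ * p t x) • (1 : Matrix (Fin d) (Fin d) ℝ)) i j)
      M.domain :=
  (contDiffOn_const.mul (hsol.smooth_pressure t ht)).mul contDiffOn_const

lemma contDiffOn_viscousStress (i j : Fin d) :
    ContDiffOn ℝ 1 (fun x => viscousStress D u t x i j) M.domain :=
  (contDiffOn_const.mul (contDiffOn_const.add (hsol.smooth_eddyViscosity t ht))).mul
    (contDiffOn_symGrad M.uniqueDiffOn_domain (hsol.smooth_velocity t ht) i j)

lemma symGrad_hull {T : Finset (E d)} (hT : T ∈ M.cells) {x : E d} (hx : x ∈ hull T) :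
    (2 * D.visc t x) • symGrad (hull T) (u t) x = viscousStress D u t x := by
  rw [viscousStress, symGrad_subset (Mesh.hull_subset_domain hT) (M.isSimplex hT).uniqueDiffOn_hull
    (hsol.differentiableOn_velocity ht) hx]

theorem continuityEq (k : ℕ) : ContinuityEq M D k (fun _ => u t) := by
  intro q _
  refine Finset.sum_eq_zero fun T hT => integral_eq_zero_of_ae ?_
  filter_upwards [ae_mem_interior_hull T] with x hx
  have h : divergence (hull T) (u t) x = 0 := by
    rw [divergence, grad_subset (Mesh.hull_subset_domain hT) (M.isSimplex hT).uniqueDiffOn_hull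
      (hsol.differentiableOn_velocity ht) (interior_subset hx)]
    exact hsol.continuity t ht x (interior_mono (Mesh.hull_subset_domain hT) hx)
  simp [h]

/-- Multiplying the momentum equation by a test function and integrating by parts in one cell. -/
lemma momentum_cell (hd : 1 ≤ d) {T : Finset (E d)} (hT : T ∈ M.cells) {v : E d → E d}
    (hv : ContDiffOn ℝ 1 v (hull T)) :
    (∫ x in hull T, ⟪deriv (fun s => u s x) t, v x⟫)
      - (∫ x in hull T, ddot (outer (u t x) (u t x)) (grad (hull T) v x))
      - (∫ x in hull T,
          ddot ((1 / D.ρ * p t x) • (1 : Matrix (Fin d) (Fin d) ℝ)) (grad (hull T) v x))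
      + (∫ x in hull T,
          ddot ((2 * D.visc t x) • symGrad (hull T) (u t) x) (symGrad (hull T) v x))
      + (∑ a ∈ T, ∫ x in hull (opp T a),
          ddot (outer (u t x) (u t x)) (outer (v x) (outwardNormal T a)) ∂μHE[d - 1])
      + (∑ a ∈ T, ∫ x in hull (opp T a),
          ddot ((1 / D.ρ * p t x) • (1 : Matrix (Fin d) (Fin d) ℝ))
            (outer (v x) (outwardNormal T a)) ∂μHE[d - 1])
      - (∑ a ∈ T, ∫ x in hull (opp T a),
          ddot ((2 * D.visc t x) • symGrad (hull T) (u t) x)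
            (outer (v x) (outwardNormal T a)) ∂μHE[d - 1])
      - (∫ x in hull T, ⟪D.f t x, v x⟫) = 0 := by
  have sT := M.isSimplex hT
  have hsub : hull T ⊆ M.domain := Mesh.hull_subset_domain hT
  have hS := sT.uniqueDiffOn_hull
  have hm := (isCompact_hull T).measurableSet
  have hA₁ := hsol.contDiffOn_convection ht
  have hA₂ := hsol.contDiffOn_pressure ht
  have hA₃ := hsol.contDiffOn_viscousStress ht
  have hcont {A : E d → Matrix (Fin d) (Fin d) ℝ}
      (hA : ∀ i j, ContDiffOn ℝ 1 (fun y => A y i j) M.domain) :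
      IntegrableOn (fun x => ⟪tensorDiv (hull T) A x, v x⟫) (hull T) :=
    integrableOn_hull ((continuousOn_tensorDiv hS fun i j => (hA i j).mono hsub).inner
      hv.continuousOn)
  have htime : IntegrableOn (fun x => ⟪deriv (fun s => u s x) t, v x⟫) (hull T) :=
    integrableOn_hull (((hsol.continuous_time t ht).mono hsub).inner hv.continuousOn)
  have hvisc : ∫ x in hull T,
      ddot ((2 * D.visc t x) • symGrad (hull T) (u t) x) (symGrad (hull T) v x) =
      ∫ x in hull T, ddot (viscousStress D u t x) (grad (hull T) v x) := by
    refine setIntegral_congr_fun hm fun x hx => ?_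
    rw [hsol.symGrad_hull ht hT hx, ddot_symGrad (transpose_viscousStress t x)]
  have hviscF : ∑ a ∈ T, ∫ x in hull (opp T a),
      ddot ((2 * D.visc t x) • symGrad (hull T) (u t) x)
        (outer (v x) (outwardNormal T a)) ∂μHE[d - 1] =
      ∑ a ∈ T, ∫ x in hull (opp T a), ddot (viscousStress D u t x)
        (outer (v x) (outwardNormal T a)) ∂μHE[d - 1] := by
    refine Finset.sum_congr rfl fun a _ =>
      setIntegral_congr_fun (isCompact_hull _).measurableSet fun x hx => ?_
    rw [hsol.symGrad_hull ht hT (hull_opp_subset T a hx)]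
  have hforce : ∫ x in hull T, ⟪D.f t x, v x⟫ =
      ∫ x in hull T, (⟪deriv (fun s => u s x) t, v x⟫
        + ⟪tensorDiv (hull T) (fun y => outer (u t y) (u t y)) x, v x⟫
        + ⟪tensorDiv (hull T)
            (fun y => (1 / D.ρ * p t y) • (1 : Matrix (Fin d) (Fin d) ℝ)) x, v x⟫
        - ⟪tensorDiv (hull T) (viscousStress D u t) x, v x⟫) := by
    refine integral_congr_ae ?_
    filter_upwards [ae_mem_interior_hull T] with x hx
    have hxT := interior_subset hx
    have hmom := hsol.momentum t ht x (interior_mono hsub hx)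
    have hdiff {A : E d → Matrix (Fin d) (Fin d) ℝ}
        (hA : ∀ i j, ContDiffOn ℝ 1 (fun y => A y i j) M.domain) :
        tensorDiv (hull T) A x = tensorDiv M.domain A x :=
      tensorDiv_subset hsub hS (fun i j => (hA i j).differentiableOn one_ne_zero) hxT
    rw [hdiff hA₁, hdiff hA₂, hdiff hA₃, tensorDiv_smul_one M.uniqueDiffOn_domain _
      ((hsol.smooth_pressure t ht).differentiableOn one_ne_zero) (hsub hxT), ← inner_add_left,
      ← inner_add_left, ← inner_sub_left]
    exact congrArg (fun z => ⟪z, v x⟫) (sub_eq_zero.1 hmom).symm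
  rw [hvisc, hviscF, hforce,
    integral_sub ((htime.fun_add (hcont hA₁)).fun_add (hcont hA₂)) (hcont hA₃),
    integral_add (htime.fun_add (hcont hA₁)) (hcont hA₂), integral_add htime (hcont hA₁),
    sT.sum_facetIntegral_ddot hd (fun i j => (hA₁ i j).mono hsub) hv,
    sT.sum_facetIntegral_ddot hd (fun i j => (hA₂ i j).mono hsub) hv,
    sT.sum_facetIntegral_ddot hd (fun i j => (hA₃ i j).mono hsub) hv]
  ring

theorem momentumEq (hd : 1 ≤ d) (k : ℕ) (Cpen : ℝ) :
    MomentumEq M D k Cpen t (fun s _ => u s) (fun _ => u t) (fun _ => p t) (fun _ => p t) := by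
  intro v hv
  simp only [cellIntegral, facetIntegral, sub_self, outer_zero_left, smul_zero, ddot_zero_left,
    integral_zero, Finset.sum_const_zero, add_zero, sub_zero]
  rw [← Finset.sum_sub_distrib, ← Finset.sum_sub_distrib, ← Finset.sum_add_distrib,
    ← Finset.sum_add_distrib, ← Finset.sum_add_distrib, ← Finset.sum_sub_distrib,
    ← Finset.sum_sub_distrib]
  exact Finset.sum_eq_zero fun T hT =>
    hsol.momentum_cell ht hd hT (contDiffOn_of_isPolyOn (hv T hT))

/-- On a boundary facet, the normal flux tested with a trace that vanishes on the Dirichlet part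
balances the Neumann terms. -/
lemma momentum_boundary_facet (hd : 1 ≤ d) {T : Finset (E d)} (hT : T ∈ M.cells) {a : E d}
    (ha : a ∈ T) (hF : hull (opp T a) ⊆ frontier M.domain) {v : E d → E d}
    (hv : ContinuousOn v (hull (opp T a)))
    (hvD : ∀ᵐ x ∂(μHE[d - 1].restrict (hull (opp T a) ∩ D.ΓD)), v x = 0) :
    ∫ x in hull (opp T a), ddot (outer (u t x) (u t x)
        + (1 / D.ρ * p t x) • (1 : Matrix (Fin d) (Fin d) ℝ) - viscousStress D u t x)
        (outer (v x) (outwardNormal T a)) ∂μHE[d - 1] =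
      (∫ x in hull (opp T a) ∩ D.ΓN, (1 - inflow (u t x) (outwardNormal T a))
        * ⟪u t x, outwardNormal T a⟫ * ⟪u t x, v x⟫ ∂μHE[d - 1]) +
      ∫ x in hull (opp T a) ∩ D.ΓN, ⟪D.h t x, v x⟫ ∂μHE[d - 1] := by
  have sT := M.isSimplex hT
  set n := outwardNormal T a
  have hsub : hull (opp T a) ⊆ M.domain :=
    (hull_opp_subset T a).trans (Mesh.hull_subset_domain hT)
  have hmF := (isCompact_hull (opp T a)).measurableSet
  have hu : ContinuousOn (u t) (hull (opp T a)) :=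
    (hsol.smooth_velocity t ht).continuousOn.mono hsub
  set B : E d → Matrix (Fin d) (Fin d) ℝ := fun x => outer (u t x) (u t x)
    + (1 / D.ρ * p t x) • (1 : Matrix (Fin d) (Fin d) ℝ) - viscousStress D u t x with hB
  have hBcont (i j : Fin d) : ContinuousOn (fun x => B x i j) (hull (opp T a)) :=
    (((hsol.contDiffOn_convection ht i j).add (hsol.contDiffOn_pressure ht i j)).sub
      (hsol.contDiffOn_viscousStress ht i j)).continuousOn.mono hsub
  have hvi := fun i => continuousOn_pi.1 ((PiLp.continuous_ofLp 2 _).comp_continuousOn hv) i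
  have hint : IntegrableOn (fun x => ddot (B x) (outer (v x) n)) (hull (opp T a)) μHE[d - 1] :=
    sT.integrableOn_facet hd ha
      (continuousOn_ddot hBcont fun i j => (hvi i).mul continuousOn_const)
  -- `(1 - λ) (u · n)` is the positive part of `u · n`, hence continuous.
  have hpos (x : E d) : (1 - inflow (u t x) n) * ⟪u t x, n⟫ = max ⟪u t x, n⟫ 0 := by
    rw [inflow]
    split_ifs with h
    · rw [max_eq_right h.le]; ring
    · rw [max_eq_left (not_lt.1 h)]; ring
  have hint' : IntegrableOn (fun x => max ⟪u t x, n⟫ 0 * ⟪u t x, v x⟫) (hull (opp T a))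
      μHE[d - 1] :=
    sT.integrableOn_facet hd ha
      (((hu.inner continuousOn_const).sup continuousOn_const).mul (hu.inner hv))
  have hDir : ∫ x in hull (opp T a) \ D.ΓN, ddot (B x) (outer (v x) n) ∂μHE[d - 1] = 0 := by
    refine integral_eq_zero_of_ae ?_
    rw [ae_restrict_iff' (hmF.inter D.measurableSet_ΓD)] at hvD
    refine (ae_restrict_iff' (hmF.diff D.measurableSet_ΓN)).2 ?_
    filter_upwards [hvD, measure_eq_zero_iff_ae_notMem.1 D.null_compl] with x hxD hx hxF
    have hxΓ : x ∈ D.ΓD := by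
      by_contra h
      exact hx ⟨hF hxF.1, fun h' => h'.elim h hxF.2⟩
    rw [ddot_outer, hxD ⟨hxF.1, hxΓ⟩]
    simp [matVec, inner_eq_sum]
  have hNeu : ∫ x in hull (opp T a) ∩ D.ΓN, ⟪D.h t x, v x⟫ ∂μHE[d - 1] =
      ∫ x in hull (opp T a) ∩ D.ΓN, (ddot (B x) (outer (v x) n)
        - max ⟪u t x, n⟫ 0 * ⟪u t x, v x⟫) ∂μHE[d - 1] := by
    refine integral_congr_ae ?_
    filter_upwards [hsol.neumann t ht T hT a ha hF] with x hx
    have h := congrArg (fun z => ⟪z, v x⟫) hx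
    simp only [inner_add_left, inner_sub_left, real_inner_smul_left, inner_zero_left] at h
    rw [← ddot_outer_eq_inner_matVec, ddot_add_left, ddot_smul_one_outer] at h
    rw [hB]
    simp only
    rw [ddot_sub_left, ddot_add_left, ddot_outer_outer, ddot_smul_one_outer, viscousStress]
    have hminmax := min_add_max ⟪u t x, n⟫ 0
    linear_combination h + ⟪u t x, v x⟫ * hminmax
  simp only [hpos]
  rw [hNeu, integral_sub (hint.mono_set inter_subset_left) (hint'.mono_set inter_subset_left),
    ← integral_inter_add_sdiff D.measurableSet_ΓN hint, hDir]
  ring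

theorem momentumConservativity (hd : 1 ≤ d) (k : ℕ) (Cpen : ℝ) :
    MomentumConservativity M D k Cpen t (fun _ => u t) (fun _ => u t) (fun _ => p t) := by
  classical
  intro v hv
  have hvcont {T : Finset (E d)} (hT : T ∈ M.cells) {a : E d} (ha : a ∈ T) :
      ContinuousOn (v (opp T a)) (hull (opp T a)) :=
    (contDiffOn_of_isPolyOn (hv.1 _ (M.opp_mem_facets hd hT ha))).continuousOn
  set B : E d → Matrix (Fin d) (Fin d) ℝ := fun x => outer (u t x) (u t x)
    + (1 / D.ρ * p t x) • (1 : Matrix (Fin d) (Fin d) ℝ) - viscousStress D u t x with hB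
  have hcombine :
      - facetIntegral M (fun _ F n x => ddot (outer (u t x) (u t x)) (outer (v F x) n))
      - facetIntegral M (fun _ F n x =>
          ddot ((1 / D.ρ * p t x) • (1 : Matrix (Fin d) (Fin d) ℝ)) (outer (v F x) n))
      + facetIntegral M (fun T F n x =>
          ddot ((2 * D.visc t x) • symGrad (hull T) (u t) x) (outer (v F x) n)) =
      - facetIntegral M (fun _ F n x => ⟪matVec (B x)ᵀ (v F x), n⟫) := by
    simp only [facetIntegral, ← Finset.sum_neg_distrib]
    rw [← Finset.sum_sub_distrib, ← Finset.sum_add_distrib]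
    refine Finset.sum_congr rfl fun T hT => ?_
    rw [← Finset.sum_sub_distrib, ← Finset.sum_add_distrib]
    refine Finset.sum_congr rfl fun a ha => ?_
    have sT := M.isSimplex hT
    have hsub : hull (opp T a) ⊆ M.domain :=
      (hull_opp_subset T a).trans (Mesh.hull_subset_domain hT)
    have hvi := fun i =>
      continuousOn_pi.1 ((PiLp.continuous_ofLp 2 _).comp_continuousOn (hvcont hT ha)) i
    have hint {A : E d → Matrix (Fin d) (Fin d) ℝ}
        (hA : ∀ i j, ContDiffOn ℝ 1 (fun y => A y i j) M.domain) :
        IntegrableOn (fun x => ddot (A x) (outer (v (opp T a) x) (outwardNormal T a)))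
          (hull (opp T a)) μHE[d - 1] :=
      sT.integrableOn_facet hd ha (continuousOn_ddot (fun i j => (hA i j).continuousOn.mono hsub)
        fun i j => (hvi i).mul continuousOn_const)
    have h₁ := hint (hsol.contDiffOn_convection ht)
    have h₂ := hint (hsol.contDiffOn_pressure ht)
    have h₃ := hint (hsol.contDiffOn_viscousStress ht)
    have hvisc : ∫ x in hull (opp T a), ddot ((2 * D.visc t x) • symGrad (hull T) (u t) x)
          (outer (v (opp T a) x) (outwardNormal T a)) ∂μHE[d - 1] =
        ∫ x in hull (opp T a), ddot (viscousStress D u t x)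
          (outer (v (opp T a) x) (outwardNormal T a)) ∂μHE[d - 1] := by
      refine setIntegral_congr_fun (isCompact_hull _).measurableSet fun x hx => ?_
      rw [hsol.symGrad_hull ht hT (hull_opp_subset T a hx)]
    simp only [← ddot_outer, hB, ddot_sub_left, ddot_add_left]
    rw [hvisc, integral_sub (h₁.fun_add h₂) h₃, integral_add h₁ h₂]
    ring
  simp only [sub_self, outer_zero_left, smul_zero, ddot_zero_left]
  have hzero : facetIntegral M (fun _ _ _ _ => 0) = 0 := by simp [facetIntegral]
  rw [hzero, sub_zero, add_zero, hcombine, M.facetIntegral_eq_boundary hd, boundaryIntegral,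
    boundaryIntegral, add_assoc, ← Finset.sum_add_distrib, neg_add_eq_zero]
  refine Finset.sum_congr rfl fun T hT => ?_
  rw [← Finset.sum_add_distrib]
  refine Finset.sum_congr (by ext; simp) fun a ha => ?_
  obtain ⟨ha, hF⟩ := Finset.mem_filter.1 ha
  simp only [← ddot_outer]
  exact hsol.momentum_boundary_facet ht hd hT ha hF (hvcont hT ha)
    (hv.2 _ (M.opp_mem_facets hd hT ha))

end IsSmoothSolution

end Solution

end HDG

end

theorem proposition1 {d : ℕ} (hd : 2 ≤ d) (M : HDG.Mesh d) (D : HDG.RANSData M)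
    (k : ℕ) (hk : 1 ≤ k) (Cpen : ℝ)
    (u : ℝ → HDG.E d → HDG.E d) (p : ℝ → HDG.E d → ℝ)
    (hsol : HDG.IsSmoothSolution M D u p) (t : ℝ) (ht : 0 < t) :
    HDG.ContinuityEq M D k (fun _ => u t) ∧
    HDG.ContinuityConservativity M D k (fun _ => u t) (fun _ => u t) ∧
    HDG.MomentumEq M D k Cpen t (fun s _ => u s) (fun _ => u t) (fun _ => p t) (fun _ => p t) ∧
    HDG.MomentumConservativity M D k Cpen t (fun _ => u t) (fun _ => u t) (fun _ => p t) :=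
  have hd' : 1 ≤ d := one_le_two.trans hd
  ⟨hsol.continuityEq ht k, HDG.continuityConservativity hd' k (u t), hsol.momentumEq ht hd' k Cpen,
    hsol.momentumConservativity ht hd' k Cpen⟩
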